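/- **Setting.** Let $\mathbf x\in\mathbb R^N$, $\mathbf u=(u^1,\dots,u^M)$, and let $u^\alpha_{\mathbf J}$ be the jet coordinates. Let $U$ be an open set of points $(\mathbf x,(u^\alpha_{\mathbf J}))$ of the infinite jet space lying over an open set $X\subseteq\mathbb R^N$. "Functions of $(\mathbf x,[\mathbf u])$" depend on $\mathbf x$ and finitely many jet coordinates, analytically on $U$. $D_i$ are the total derivatives, $\mathbf D_{\mathbf J}=D_1^{j^1}\cdots D_N^{j^N}$, $(-\mathbf D)_{\mathbf J}=(-1)^{|\mathbf J|}\mathbf D_{\mathbf J}$. Sums over repeated indices are understood. Let $\mathcal A=(\mathcal A_1,\dots,\mathcal A_m)$ be functions of $(\mathbf x,[\mathbf u])$. We write $f|_0=0$ if $f$ vanishes on all formal power-series solutions of $\mathcal A=0$ in $U$, i.e. if $f$ and all its total derivatives vanish at each point of $U$ at which all $\mathcal A_\mu$ and all their total derivatives vanish. Let $\mathtt g=(\mathtt g^1,\dots,\mathtt g^R)$ be smooth functions of $\mathbf x$ subject to linear constraints $$\mathscr D^l_r\mathtt g^r=0,\qquad l=1,\dots,L,\tag{1}$$ where $\mathscr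 D^l_r=d^{l,\mathbf J}_r(\mathbf x)\mathbf D_{\mathbf J}$ are differential operators with coefficients analytic on $X$, with formal adjoints $(\mathscr D^l_r)^\dagger f=(-\mathbf D)_{\mathbf J}(d^{l,\mathbf J}_r f)$. The set (1) is assumed to be *complete* on $X$: the derivatives of local solutions $\mathtt g$ of (1) are subject to no conditions other than those obtained by differentiating (1). Precisely, for any finite set of jet coordinates $\mathtt g^r_{\mathbf J}$, there are finitely many of the equations $\mathbf D_{\mathbf K}(\mathscr D^l_r\mathtt g^r)=0$ that, as linear equations for the jet coordinates of $\mathtt g$ at a point, have locally constant rank on $X$, and such that for every $\mathbf x\in X$ and every jet at $\mathbf x$ satisfying these equations, there is a smooth solution of (1) near $\mathbf x$ whose derivatives in the given finite set take the values prescribed by that jet. A *family of conservation laws* of $\mathcal A=0$ that is linear homogeneous in $\mathtt g$ subject to (1) is a function $\mathcal C(\mathbf x,[\mathbf u],[\mathtt g])$, linear homogeneous in $[\mathtt g]$, for which there are functions $F^i(\mathbf x,[\mathbf u],[\mathtt g])$ such that, for all local smooth solutions $\mathtt g$ of (1), $\mathcal C=D_iF^i$ and $\mathcal C|_0=0$.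 Two families $\mathcal C_1,\mathcal C_2$ are *equivalent* if there are functions $\widehat F^i(\mathbf x,[\mathbf u],[\mathtt g])$ such that, for all local smooth solutions $\mathtt g$ of (1), $\mathcal C_1-\mathcal C_2=D_i\widehat F^i$ and $\widehat F^i|_0=0$ for all $i$. **Theorem.** Let $\mathcal C(\mathbf x,[\mathbf u],[\mathtt g])$ be a family of conservation laws of $\mathcal A=0$ that is linear homogeneous in $\mathtt g$, where $\mathtt g$ is subject to the complete set of constraints (1). (i) There exist functions $\boldsymbol\lambda=(\lambda_1(\mathbf x,[\mathbf u]),\dots,\lambda_L(\mathbf x,[\mathbf u]))$ on $U$ such that $$(-\mathbf D)_{\mathbf J}\left(\frac{\partial\mathcal C}{\partial\mathtt g^r_{\mathbf J}}\right)+(\mathscr D^l_r)^\dagger\lambda_l=0,\qquad r=1,\dots,R.\tag{2}$$ (ii) Let $\boldsymbol\lambda$ be any solution of (2). For each set of differential operators $\mathscr D^r=P^{r,\mathbf J}(\mathbf x,[\mathbf u])\mathbf D_{\mathbf J}$ such that $\mathscr D^r(\mathscr D^l_r)^\dagger\lambda_l=0$, there is the corresponding syzygy $$\mathscr D^r(-\mathbf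 D)_{\mathbf J}\left(\frac{\partial\mathcal C}{\partial\mathtt g^r_{\mathbf J}}\right)=0 .$$ (iii) Suppose that the expression $\mathcal C(\mathbf x,[\mathbf u],[\mathtt g])$ is so written that $\mathcal C|_0=0$ holds identically in $[\mathtt g]$, that is, for all smooth functions $\mathtt g$ whether or not they satisfy (1) (as is the case, for instance, if $\mathcal C=\mathcal Q^\mu(\mathbf x,[\mathbf u],[\mathtt g])\mathcal A_\mu$ identically in $[\mathtt g]$). Then, for every solution $\boldsymbol\lambda$ of (2), $$\mathcal C_{\boldsymbol\lambda}:=\lambda_l\,\mathscr D^l_r\mathtt g^r-\mathtt g^r(\mathscr D^l_r)^\dagger\lambda_l$$ is a family of conservation laws of $\mathcal A=0$ that is linear homogeneous in $\mathtt g$ subject to (1), and it is equivalent to $\mathcal C$. (The case of interest is that not all $\mathtt g^r$ are free, i.e. not all $\mathscr D^l_r$ are zero; otherwise $\mathcal C_{\boldsymbol\lambda}=0$ and $\mathcal C$ is trivial.) -/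

import Mathlib

open Topology
open scoped ContDiff

noncomputable section

namespace ConsLaw

/-- Multi-indices `J = (j¹, …, jᴺ)`. -/
abbrev MultiIndex (N : ℕ) : Type := Fin N → ℕ

/-- Points `(x, (u^a_J))` of the infinite jet space over `ℝᴺ` with dependent variables indexed by
`α`, where `u^a_J` is the coordinate for the `J`-th derivative of `u^a`. -/
abbrev Jet (N : ℕ) (α : Type) : Type := (Fin N → ℝ) × (α → MultiIndex N → ℝ)

/-- `D^J = D₁^{j¹} ⋯ D_N^{jᴺ}` for a family `D₁, …, D_N` of operators on functions `E → ℝ`. -/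
def multiPow {N : ℕ} {E : Type} (D : Fin N → (E → ℝ) → (E → ℝ)) (J : MultiIndex N)
    (f : E → ℝ) : E → ℝ :=
  (List.finRange N).foldr (fun i h => (D i)^[J i] h) f

/-- The partial derivative `∂^{|J|} g / ∂x^J` of a function of `x` only. -/
def xDeriv {N : ℕ} (J : MultiIndex N) (g : (Fin N → ℝ) → ℝ) : (Fin N → ℝ) → ℝ :=
  multiPow (fun i h x => lineDeriv ℝ h x (Pi.single i 1)) J g

/-- The jet coordinates `(g^r_J(x))` of a tuple of functions of `x`. -/
def jetOf {N : ℕ} {ρ : Type} (g : ρ → (Fin N → ℝ) → ℝ) (x : Fin N → ℝ) : ρ → MultiIndex N → ℝ :=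
  fun r J => xDeriv J (g r) x

section Calculus

variable {N : ℕ} {α : Type} [DecidableEq α]

/-- Projection of the infinite jet space to `x` and finitely many jet coordinates. -/
def proj (S : Finset (α × MultiIndex N)) (z : Jet N α) : (Fin N → ℝ) × (S → ℝ) :=
  (z.1, fun s => z.2 s.1.1 s.1.2)

/-- `f(x,[u])` is a differential function on `U`: there it depends on `x` and finitely many
jet coordinates only, and it depends on these (real-)analytically. -/
def IsDiffFun (U : Set (Jet N α)) (f : Jet N α → ℝ) : Prop :=
  ∃ (S : Finset (α × MultiIndex N)) (F : (Fin N → ℝ) × (S → ℝ) → ℝ),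
    AnalyticOnNhd ℝ F (proj S '' U) ∧ ∀ z ∈ U, f z = F (proj S z)

/-- The partial derivative `∂f/∂x^i`. -/
def pdx (i : Fin N) (f : Jet N α → ℝ) (z : Jet N α) : ℝ :=
  lineDeriv ℝ f z (Pi.single i 1, 0)

/-- The partial derivative `∂f/∂u^a_J`. -/
def pdu (a : α) (J : MultiIndex N) (f : Jet N α → ℝ) (z : Jet N α) : ℝ :=
  lineDeriv ℝ f z (0, Pi.single a (Pi.single J 1))

/-- The total derivative `D_i f = ∂f/∂x^i + u^a_{J+1_i} ∂f/∂u^a_J` (a finite sum at each point at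
which `f` is a differential function). -/
def totalD (i : Fin N) (f : Jet N α → ℝ) (z : Jet N α) : ℝ :=
  pdx i f z + ∑ᶠ p : α × MultiIndex N, z.2 p.1 (p.2 + Pi.single i 1) * pdu p.1 p.2 f z

/-- `D_J f`. -/
def totalDs (J : MultiIndex N) (f : Jet N α → ℝ) : Jet N α → ℝ :=
  multiPow totalD J f

/-- `(-D)_J f = (-1)^{|J|} D_J f`. -/
def negDs (J : MultiIndex N) (f : Jet N α → ℝ) (z : Jet N α) : ℝ :=
  (-1) ^ (∑ i, J i) * totalDs J f z

/-- `Div F = D_i F^i`. -/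
def divergence (F : Fin N → Jet N α → ℝ) (z : Jet N α) : ℝ :=
  ∑ i, totalD i (F i) z

/-- `P f` for the differential operator `P = ∑_J P_J(x,[u]) D_J`, given by its coefficients. -/
def applyOp (P : MultiIndex N →₀ (Jet N α → ℝ)) (f : Jet N α → ℝ) (z : Jet N α) : ℝ :=
  P.sum fun J a => a z * totalDs J f z

/-- `P† f = ∑_J (-D)_J (p_J f)` for the formal adjoint of the differential operator
`P = ∑_J p_J(x) D_J`, whose coefficients depend on `x` only. -/
def adjointOp (P : MultiIndex N →₀ ((Fin N → ℝ) → ℝ)) (f : Jet N α → ℝ) (z : Jet N α) : ℝ :=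
  P.sum fun J p => negDs J (fun y => p y.1 * f y) z

/-- `f|₀ = 0`: `f` vanishes on the (formal) solutions in `U` of the system `A = 0`. A point of the
infinite jet space is a formal power series `u` at `x`. This series is a solution if every `A_μ`
vanishes on it as a power series, that is, if all `D_K A_μ` vanish at the point; likewise `f`
vanishes on the series if all `D_K f` vanish at the point. -/
def VanishesOnShell {m : ℕ} (A : Fin m → Jet N α → ℝ) (U : Set (Jet N α))
    (f : Jet N α → ℝ) : Prop :=
  ∀ z ∈ U, (∀ μ K, totalDs K (A μ) z = 0) → ∀ K, totalDs K f z = 0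

end Calculus

section Families

variable {N M m R L : ℕ}

/-- The point `(x,[u],[g])` of the jet space with all dependent variables `u` and `g`. -/
def extend (z : Jet N (Fin M)) (γ : Fin R → MultiIndex N → ℝ) : Jet N (Fin M ⊕ Fin R) :=
  (z.1, Sum.elim z.2 γ)

/-- The set of all `(x,[u],[g])` with `(x,[u])` in `U`. -/
def cyl (R : ℕ) (U : Set (Jet N (Fin M))) : Set (Jet N (Fin M ⊕ Fin R)) :=
  {w | (w.1, fun a => w.2 (Sum.inl a)) ∈ U}

/-- The function of `(x,[u])` obtained from `C(x,[u],[g])` by inserting functions `g^r(x)`. -/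
def plug (C : Jet N (Fin M ⊕ Fin R) → ℝ) (g : Fin R → (Fin N → ℝ) → ℝ) (z : Jet N (Fin M)) : ℝ :=
  C (extend z (jetOf g z.1))

/-- The constraint expression `∑_r 𝒟^l_r g^r` as a function of `(x,[g])`, where
`𝒟^l_r = ∑_J (d l r J)(x) D_J`. -/
def constraint (d : Fin L → Fin R → MultiIndex N →₀ ((Fin N → ℝ) → ℝ)) (l : Fin L)
    (w : Jet N (Fin R)) : ℝ :=
  ∑ r, (d l r).sum fun J p => p w.1 * w.2 r J

/-- `g` is a tuple of smooth functions on `V` that satisfies the constraints there. -/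
def IsAdmissible (d : Fin L → Fin R → MultiIndex N →₀ ((Fin N → ℝ) → ℝ)) (V : Set (Fin N → ℝ))
    (g : Fin R → (Fin N → ℝ) → ℝ) : Prop :=
  (∀ r, ContDiffOn ℝ ∞ (g r) V) ∧ ∀ l, ∀ x ∈ V, constraint d l (x, jetOf g x) = 0

/-- The rank at `x` of the linear forms `D_K (∑_r 𝒟^l_r g^r)` in `[g]`, `(l, K) ∈ T`. -/
def prolongRank (d : Fin L → Fin R → MultiIndex N →₀ ((Fin N → ℝ) → ℝ))
    (T : Finset (Fin L × MultiIndex N)) (x : Fin N → ℝ) : ℕ :=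
  Module.finrank ℝ (Submodule.span ℝ
    ((fun (t : Fin L × MultiIndex N) (γ : Fin R → MultiIndex N → ℝ) =>
      totalDs t.2 (constraint d t.1) (x, γ)) '' (T : Set (Fin L × MultiIndex N))))

/-- The set of constraints is complete on `X`: the derivatives of functions `g` that satisfy the
constraints are subject to no other conditions than those obtained by differentiating the
constraints. For any finitely many derivatives `g^r_J`, finitely many of the equations
`D_K (∑_r 𝒟^l_r g^r) = 0`, which form a system of locally constant rank, contain all the conditions:
whatever jet satisfies these equations at a point `x`, the derivatives in question take the values
prescribed by this jet for some local solution `g` of the constraints. -/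
def IsCompleteSystem (d : Fin L → Fin R → MultiIndex N →₀ ((Fin N → ℝ) → ℝ))
    (X : Set (Fin N → ℝ)) : Prop :=
  ∀ S : Finset (Fin R × MultiIndex N), ∃ T : Finset (Fin L × MultiIndex N),
    (∀ x ∈ X, ∀ᶠ y in 𝓝 x, prolongRank d T y = prolongRank d T x) ∧
    ∀ x ∈ X, ∀ γ : Fin R → MultiIndex N → ℝ,
      (∀ t ∈ T, totalDs t.2 (constraint d t.1) (x, γ) = 0) →
      ∃ V : Set (Fin N → ℝ), IsOpen V ∧ x ∈ V ∧ V ⊆ X ∧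
        ∃ g : Fin R → (Fin N → ℝ) → ℝ, IsAdmissible d V g ∧
          ∀ s ∈ S, jetOf g x s.1 s.2 = γ s.1 s.2

/-- `C(x,[u],[g])` is linear homogeneous in `g`, at every point `(x,[u])` of `U`. -/
def IsLinearHomogeneous (U : Set (Jet N (Fin M))) (C : Jet N (Fin M ⊕ Fin R) → ℝ) : Prop :=
  ∀ z ∈ U, ∀ (c : ℝ) (γ γ' : Fin R → MultiIndex N → ℝ),
    C (extend z (c • γ + γ')) = c * C (extend z γ) + C (extend z γ')

/-- `C(x,[u],[g])` is a family of conservation laws of `A = 0` that is linear homogeneous in `g`,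
where `g` is subject to the constraints: there are `F^i(x,[u],[g])` such that, for all (local)
functions `g` that satisfy the constraints, `C = D_i F^i` and `C|₀ = 0`. -/
def IsConservationLawFamily (A : Fin m → Jet N (Fin M) → ℝ)
    (d : Fin L → Fin R → MultiIndex N →₀ ((Fin N → ℝ) → ℝ)) (X : Set (Fin N → ℝ))
    (U : Set (Jet N (Fin M))) (C : Jet N (Fin M ⊕ Fin R) → ℝ) : Prop :=
  IsDiffFun (cyl R U) C ∧ IsLinearHomogeneous U C ∧
  ∃ F : Fin N → Jet N (Fin M ⊕ Fin R) → ℝ, (∀ i, IsDiffFun (cyl R U) (F i)) ∧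
    ∀ (V : Set (Fin N → ℝ)) (g : Fin R → (Fin N → ℝ) → ℝ), IsOpen V → V ⊆ X → IsAdmissible d V g →
      (∀ z ∈ U, z.1 ∈ V → plug C g z = divergence (fun i => plug (F i) g) z) ∧
      VanishesOnShell A {z ∈ U | z.1 ∈ V} (plug C g)

/-- The families `C₁`, `C₂` are equivalent: there are `F^i(x,[u],[g])` such that, for all (local)
functions `g` that satisfy the constraints, `C₁ - C₂ = D_i F^i` and `F^i|₀ = 0`. -/
def AreEquivalent (A : Fin m → Jet N (Fin M) → ℝ)
    (d : Fin L → Fin R → MultiIndex N →₀ ((Fin N → ℝ) → ℝ)) (X : Set (Fin N → ℝ))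
    (U : Set (Jet N (Fin M))) (C₁ C₂ : Jet N (Fin M ⊕ Fin R) → ℝ) : Prop :=
  ∃ F : Fin N → Jet N (Fin M ⊕ Fin R) → ℝ, (∀ i, IsDiffFun (cyl R U) (F i)) ∧
    ∀ (V : Set (Fin N → ℝ)) (g : Fin R → (Fin N → ℝ) → ℝ), IsOpen V → V ⊆ X → IsAdmissible d V g →
      (∀ z ∈ U, z.1 ∈ V → plug C₁ g z - plug C₂ g z = divergence (fun i => plug (F i) g) z) ∧
      ∀ i, VanishesOnShell A {z ∈ U | z.1 ∈ V} (plug (F i) g)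

/-- `∑_J (-D)_J (∂C/∂g^r_J)`, as a function of `(x,[u])`. For `C` linear homogeneous in `g`, the
partial derivatives do not depend on `[g]`; they are taken at `[g] = 0`. -/
def eulerG (C : Jet N (Fin M ⊕ Fin R) → ℝ) (r : Fin R) (z : Jet N (Fin M)) : ℝ :=
  ∑ᶠ J : MultiIndex N, negDs J (fun y => pdu (Sum.inr r) J C (extend y 0)) z

/-- `∑_l (𝒟^l_r)† λ_l`. -/
def adjointSum (d : Fin L → Fin R → MultiIndex N →₀ ((Fin N → ℝ) → ℝ))
    (lam : Fin L → Jet N (Fin M) → ℝ) (r : Fin R) (z : Jet N (Fin M)) : ℝ :=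
  ∑ l, adjointOp (d l r) (lam l) z

/-- `λ(x,[u])` satisfies `(-D)_J (∂C/∂g^r_J) + (𝒟^l_r)† λ_l = 0` for all `r`, identically on `U`. -/
def IsMultiplier (d : Fin L → Fin R → MultiIndex N →₀ ((Fin N → ℝ) → ℝ))
    (U : Set (Jet N (Fin M))) (C : Jet N (Fin M ⊕ Fin R) → ℝ)
    (lam : Fin L → Jet N (Fin M) → ℝ) : Prop :=
  (∀ l, IsDiffFun U (lam l)) ∧ ∀ r, ∀ z ∈ U, eulerG C r z + adjointSum d lam r z = 0

/-- `C_λ = λ_l 𝒟^l_r g^r - g^r (𝒟^l_r)† λ_l`, as a function of `(x,[u],[g])`. -/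
def multiplierLaw (d : Fin L → Fin R → MultiIndex N →₀ ((Fin N → ℝ) → ℝ))
    (lam : Fin L → Jet N (Fin M) → ℝ) (w : Jet N (Fin M ⊕ Fin R)) : ℝ :=
  let z : Jet N (Fin M) := (w.1, fun a => w.2 (Sum.inl a))
  let γ : Fin R → MultiIndex N → ℝ := fun r => w.2 (Sum.inr r)
  ∑ l, lam l z * constraint d l (w.1, γ) - ∑ r, γ r 0 * adjointSum d lam r z

end Families

end ConsLaw

end

open ConsLaw

/-! Existence of `λ`. Put `H = C - D_i F^i`. Inserting a solution `g` of the constraints gives zero,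
and so does inserting `t g` for every real `t`; hence the linear part of `H` in `[g]` vanishes on
the jets of all solutions (`linearization_eq_zero_of_admissible`). Only the linear part is used,
since the `F^i` need not be linear in `g`. By completeness, at each point the coefficients
`∂H/∂g^r_J` form a linear form that vanishes on the kernel of a finite matrix `A(x)`, whose rows are
differentiated constraints. Linear algebra makes this form a combination of the rows. The
combination can be chosen analytically because the rank of `A` is locally constant: a generalized
inverse of `A Aᵀ` is rational in its entries, with a denominator that does not vanish
(`mul_genInv_mul`, `analyticAt_genInv`). So the linear part of `H` is `∑ μ_t D_K(𝒟^l_r g^r)` with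
differential functions `μ_t` (`exists_combination`).

Now apply the Euler operator with respect to `g`. It sees only the linear part, annihilates total
derivatives (`eulerG_totalD`), and therefore permits integration by parts: `D_K` moves onto `μ_t` as
`(-D)_K`, and `𝒟^l_r` becomes its adjoint (`eulerG_combination`). Collecting the terms that belong
to the same `l` gives `λ_l = -∑ (-D)_K μ_t`.

Syzygies follow by applying the operators to the identity for `λ`.

Equivalence. Write `C = ∑ c_{r,J} g^r_J`. If `C` vanishes on shell for every smooth `g`, then each
`c_{r,J}` vanishes on shell: insert exponentials and compare coefficients of polynomials in `ξ`
(`vanishesOnShell_gCoeff`). Integrating by parts in `g` produces fluxes that contain factors `D_K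
c_{r,J}`, hence vanish on shell, and leaves `g^r (-D)_J c_{r,J}` (`isTrivialDivergence_sub_eulerG`).
On solutions of the constraints this remainder equals `C_λ` by the equation for `λ`
(`plug_multiplierLaw`). -/

open Topology
open scoped ContDiff

noncomputable section

namespace ConsLaw

/-! ### Multi-index powers of a family of commuting operators. -/

section MultiPow

variable {N : ℕ} {E : Type}

/-- `multiPow` with the directions restricted to a list. -/
def listPow (D : Fin N → (E → ℝ) → (E → ℝ)) (J : MultiIndex N) (l : List (Fin N))
    (f : E → ℝ) : E → ℝ :=
  l.foldr (fun i h => (D i)^[J i] h) f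

theorem multiPow_eq_listPow (D : Fin N → (E → ℝ) → (E → ℝ)) (J : MultiIndex N) (f : E → ℝ) :
    multiPow D J f = listPow D J (List.finRange N) f := rfl

variable {D : Fin N → (E → ℝ) → (E → ℝ)} {P : (E → ℝ) → Prop} {W : Set E}

theorem iterate_mem (hP : ∀ i f, P f → P (D i f)) (i : Fin N) (k : ℕ) {f : E → ℝ} (hf : P f) :
    P ((D i)^[k] f) := by
  induction k with
  | zero => exact hf
  | succ k ih => rw [Function.iterate_succ_apply']; exact hP i _ ih

theorem listPow_mem (hP : ∀ i f, P f → P (D i f)) (J : MultiIndex N) (l : List (Fin N))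
    {f : E → ℝ} (hf : P f) : P (listPow D J l f) := by
  induction l with
  | nil => exact hf
  | cons i l ih => exact iterate_mem hP i _ ih

theorem iterate_eqOn (hD : ∀ i f g, Set.EqOn f g W → Set.EqOn (D i f) (D i g) W) (i : Fin N)
    (k : ℕ) {f g : E → ℝ} (hfg : Set.EqOn f g W) : Set.EqOn ((D i)^[k] f) ((D i)^[k] g) W := by
  induction k with
  | zero => exact hfg
  | succ k ih => simp only [Function.iterate_succ_apply']; exact hD i _ _ ih

theorem listPow_eqOn (hD : ∀ i f g, Set.EqOn f g W → Set.EqOn (D i f) (D i g) W)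
    (J : MultiIndex N) (l : List (Fin N)) {f g : E → ℝ} (hfg : Set.EqOn f g W) :
    Set.EqOn (listPow D J l f) (listPow D J l g) W := by
  induction l with
  | nil => exact hfg
  | cons i l ih => exact iterate_eqOn hD i _ ih

/-- The operators in question commute only on well-behaved functions and only on an open set. This
is why a stable class `P` and equality on `W` are carried along instead of plain equality of
functions. -/
theorem iterate_comm_eqOn (hP : ∀ i f, P f → P (D i f))
    (hD : ∀ i f g, Set.EqOn f g W → Set.EqOn (D i f) (D i g) W)
    (hc : ∀ i j f, P f → Set.EqOn (D i (D j f)) (D j (D i f)) W)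
    (i j : Fin N) (k : ℕ) {f : E → ℝ} (hf : P f) :
    Set.EqOn ((D i)^[k] (D j f)) (D j ((D i)^[k] f)) W := by
  induction k with
  | zero => exact fun _ _ => rfl
  | succ k ih =>
    simp only [Function.iterate_succ_apply']
    exact (hD i _ _ ih).trans (hc i j _ (iterate_mem hP i k hf))

theorem listPow_comm_eqOn (hP : ∀ i f, P f → P (D i f))
    (hD : ∀ i f g, Set.EqOn f g W → Set.EqOn (D i f) (D i g) W)
    (hc : ∀ i j f, P f → Set.EqOn (D i (D j f)) (D j (D i f)) W)
    (J : MultiIndex N) (l : List (Fin N)) (j : Fin N) {f : E → ℝ} (hf : P f) :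
    Set.EqOn (listPow D J l (D j f)) (D j (listPow D J l f)) W := by
  induction l with
  | nil => exact fun _ _ => rfl
  | cons i l ih =>
    exact (iterate_eqOn hD i _ ih).trans
      (iterate_comm_eqOn hP hD hc i j _ (listPow_mem hP J l hf))

theorem listPow_add_single_of_notMem (J : MultiIndex N) (l : List (Fin N)) (j : Fin N)
    (hj : j ∉ l) (f : E → ℝ) : listPow D (J + Pi.single j 1) l f = listPow D J l f := by
  induction l with
  | nil => rfl
  | cons i l ih =>
    simp only [List.mem_cons, not_or] at hj
    have h := ih hj.2
    simp only [listPow, List.foldr_cons] at h ⊢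
    rw [h]
    simp [Pi.single_eq_of_ne (Ne.symm hj.1)]

/-- The additional factor arises at the position of `j` in the list and is commuted outwards past
the operators to its left; `Nodup` ensures that it arises only once. -/
theorem listPow_add_single (hP : ∀ i f, P f → P (D i f))
    (hD : ∀ i f g, Set.EqOn f g W → Set.EqOn (D i f) (D i g) W)
    (hc : ∀ i j f, P f → Set.EqOn (D i (D j f)) (D j (D i f)) W)
    (J : MultiIndex N) (l : List (Fin N)) (hl : l.Nodup) (j : Fin N) (hj : j ∈ l)
    {f : E → ℝ} (hf : P f) :
    Set.EqOn (listPow D (J + Pi.single j 1) l f) (D j (listPow D J l f)) W := by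
  induction l with
  | nil => simp at hj
  | cons i l ih =>
    rw [List.nodup_cons] at hl
    change Set.EqOn ((D i)^[(J + Pi.single j 1 : MultiIndex N) i] (listPow D (J + Pi.single j 1) l f))
      (D j ((D i)^[J i] (listPow D J l f))) W
    by_cases hij : j = i
    · subst hij
      rw [listPow_add_single_of_notMem J l j hl.1 f, ← Function.iterate_succ_apply' (D j)]
      simp only [Pi.add_apply, Pi.single_eq_same]
      exact fun _ _ => rfl
    · have hjl : j ∈ l := by simpa [hij] using hj
      have e : (J + Pi.single j 1 : MultiIndex N) i = J i := by simp [Pi.single_eq_of_ne (Ne.symm hij)]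
      rw [e]
      exact (iterate_eqOn hD i _ (ih hl.2 hjl)).trans
        (iterate_comm_eqOn hP hD hc i j _ (listPow_mem hP J l hf))

theorem multiPow_mem (hP : ∀ i f, P f → P (D i f)) (J : MultiIndex N)
    {f : E → ℝ} (hf : P f) : P (multiPow D J f) := listPow_mem hP J _ hf

theorem multiPow_eqOn (hD : ∀ i f g, Set.EqOn f g W → Set.EqOn (D i f) (D i g) W)
    (J : MultiIndex N) {f g : E → ℝ} (hfg : Set.EqOn f g W) :
    Set.EqOn (multiPow D J f) (multiPow D J g) W := listPow_eqOn hD J _ hfg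

theorem multiPow_comm_eqOn (hP : ∀ i f, P f → P (D i f))
    (hD : ∀ i f g, Set.EqOn f g W → Set.EqOn (D i f) (D i g) W)
    (hc : ∀ i j f, P f → Set.EqOn (D i (D j f)) (D j (D i f)) W)
    (J : MultiIndex N) (j : Fin N) {f : E → ℝ} (hf : P f) :
    Set.EqOn (multiPow D J (D j f)) (D j (multiPow D J f)) W :=
  listPow_comm_eqOn hP hD hc J _ j hf

theorem multiPow_add_single (hP : ∀ i f, P f → P (D i f))
    (hD : ∀ i f g, Set.EqOn f g W → Set.EqOn (D i f) (D i g) W)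
    (hc : ∀ i j f, P f → Set.EqOn (D i (D j f)) (D j (D i f)) W)
    (J : MultiIndex N) (j : Fin N) {f : E → ℝ} (hf : P f) :
    Set.EqOn (multiPow D (J + Pi.single j 1) f) (D j (multiPow D J f)) W :=
  listPow_add_single hP hD hc J _ (List.nodup_finRange N) j (List.mem_finRange j) hf

/-- A map between function spaces that intertwines two families of operators on a class
of functions intertwines their multi-index powers. -/
theorem multiPow_intertwine {E' : Type} {D' : Fin N → (E' → ℝ) → (E' → ℝ)} {W' : Set E'}
    (T : (E → ℝ) → (E' → ℝ)) (hP : ∀ i f, P f → P (D i f))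
    (hD' : ∀ i f g, Set.EqOn f g W' → Set.EqOn (D' i f) (D' i g) W')
    (hT : ∀ i f, P f → Set.EqOn (D' i (T f)) (T (D i f)) W')
    (J : MultiIndex N) {f : E → ℝ} (hf : P f) :
    Set.EqOn (multiPow D' J (T f)) (T (multiPow D J f)) W' := by
  have hit : ∀ i k f, P f → Set.EqOn ((D' i)^[k] (T f)) (T ((D i)^[k] f)) W' := by
    intro i k f hf
    induction k with
    | zero => exact fun _ _ => rfl
    | succ k ih =>
      simp only [Function.iterate_succ_apply']
      exact (hD' i _ _ ih).trans (hT i _ (iterate_mem hP i k hf))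
  rw [multiPow_eq_listPow, multiPow_eq_listPow]
  induction List.finRange N with
  | nil => exact fun _ _ => rfl
  | cons i l ih => exact (iterate_eqOn hD' i _ ih).trans (hit i _ _ (listPow_mem hP J l hf))

theorem multiPow_zero (D : Fin N → (E → ℝ) → (E → ℝ)) (f : E → ℝ) :
    multiPow D 0 f = f := by
  rw [multiPow_eq_listPow]
  induction List.finRange N with
  | nil => rfl
  | cons i l ih => exact ih

end MultiPow

/-- Induction on multi-indices: every multi-index is reached from `0` by unit steps. -/
theorem multiIndex_induction {N : ℕ} {p : MultiIndex N → Prop} (h0 : p 0)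
    (hs : ∀ J i, p J → p (J + Pi.single i 1)) (J : MultiIndex N) : p J := by
  obtain ⟨k, hk⟩ : ∃ k, ∑ i, J i = k := ⟨_, rfl⟩
  induction k generalizing J with
  | zero =>
    have : J = 0 := by
      funext i
      exact (Finset.sum_eq_zero_iff.1 hk) i (Finset.mem_univ i)
    rwa [this]
  | succ k ih =>
    obtain ⟨i, hi⟩ : ∃ i, J i ≠ 0 := by
      by_contra! h
      simp [h] at hk
    have e : J = (J - Pi.single i 1) + Pi.single i 1 := by
      funext j
      by_cases hj : j = i
      · subst hj; simp; omega
      · simp [Pi.single_eq_of_ne hj]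
    rw [e]
    refine hs _ _ (ih _ ?_)
    rw [e] at hk
    simp only [Pi.add_apply, Finset.sum_add_distrib, Finset.sum_pi_single', Finset.mem_univ,
      if_true] at hk
    simpa using hk

/-! ### Differential functions and their closure properties. -/

section Calculus

variable {N : ℕ} {α β : Type}

theorem proj_add_smul (S : Finset (α × MultiIndex N)) (z v : Jet N α) (t : ℝ) :
    proj S (z + t • v) = proj S z + t • proj S v := rfl

/-- Through each point `z` of `U` passes a continuous section of the projection, obtained by
freezing the coordinates outside `S` at their values in `z`. -/
theorem isOpen_proj_image (S : Finset (α × MultiIndex N)) {U : Set (Jet N α)} (hU : IsOpen U) :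
    IsOpen (proj S '' U) := by
  classical
  rw [isOpen_iff_mem_nhds]
  rintro _ ⟨z, hz, rfl⟩
  let σ : (Fin N → ℝ) × (S → ℝ) → Jet N α := fun p =>
    (p.1, fun a J => if h : (a, J) ∈ S then p.2 ⟨(a, J), h⟩ else z.2 a J)
  have hσ : Continuous σ := by
    refine continuous_fst.prodMk (continuous_pi fun a => continuous_pi fun J => ?_)
    by_cases h : (a, J) ∈ S
    · simp only [h, dif_pos]; fun_prop
    · simp only [h, dif_neg, not_false_iff]; fun_prop
  have hz' : σ (proj S z) = z := by
    refine Prod.ext rfl (funext fun a => funext fun J => ?_)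
    simp [σ, proj]
  have hmem : σ ⁻¹' U ∈ 𝓝 (proj S z) :=
    hσ.continuousAt.preimage_mem_nhds (hU.mem_nhds (by rwa [hz']))
  filter_upwards [hmem] with p hp
  refine ⟨σ p, hp, Prod.ext rfl (funext fun s => ?_)⟩
  simp [σ, proj]

/-- On `U`, the function `f` is a `Cⁿ` function of `x` and the jet coordinates in `S`. -/
def IsDiffFunIn (n : ℕ∞ω) (S : Finset (α × MultiIndex N)) (U : Set (Jet N α))
    (f : Jet N α → ℝ) : Prop :=
  ∃ F : (Fin N → ℝ) × (S → ℝ) → ℝ, ContDiffOn ℝ n F (proj S '' U) ∧ ∀ z ∈ U, f z = F (proj S z)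

/-- On `U`, the function `f` is a `Cⁿ` function of `x` and finitely many jet coordinates. -/
def IsDiffFunOf (n : ℕ∞ω) (U : Set (Jet N α)) (f : Jet N α → ℝ) : Prop :=
  ∃ S, IsDiffFunIn n S U f

/-- Analyticity becomes the case `n = ω` of a calculus valid for all `n ≥ ∞`. The case `n = ∞` is
needed as well, because inserting functions `g(x)` that are merely smooth destroys analyticity. -/
theorem isDiffFun_iff {U : Set (Jet N α)} (hU : IsOpen U) {f : Jet N α → ℝ} :
    IsDiffFun U f ↔ IsDiffFunOf ω U f := by
  refine exists_congr fun S => exists_congr fun F => and_congr_left fun _ => ?_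
  have ho := isOpen_proj_image S hU
  rw [contDiffOn_omega_iff_analyticOn ho.uniqueDiffOn, ho.analyticOn_iff_analyticOnNhd]

theorem IsDiffFunIn.mono {n : ℕ∞ω} {S S' : Finset (α × MultiIndex N)} (h : S ⊆ S')
    {U : Set (Jet N α)} {f : Jet N α → ℝ} (hf : IsDiffFunIn n S U f) : IsDiffFunIn n S' U f := by
  obtain ⟨F, hF, hfF⟩ := hf
  refine ⟨fun p => F (p.1, fun s => p.2 ⟨s.1, h s.2⟩), hF.comp ?_ ?_, hfF⟩
  · exact ContDiff.contDiffOn (by fun_prop)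
  · rintro _ ⟨z, hz, rfl⟩
    exact ⟨z, hz, rfl⟩

theorem IsDiffFunOf.of_le {n k : ℕ∞ω} (h : k ≤ n) {U : Set (Jet N α)} {f : Jet N α → ℝ}
    (hf : IsDiffFunOf n U f) : IsDiffFunOf k U f := by
  obtain ⟨S, F, hF, hfF⟩ := hf
  exact ⟨S, F, hF.of_le h, hfF⟩

theorem IsDiffFunOf.mono {n : ℕ∞ω} {U U' : Set (Jet N α)} (h : U' ⊆ U) {f : Jet N α → ℝ}
    (hf : IsDiffFunOf n U f) : IsDiffFunOf n U' f := by
  obtain ⟨S, F, hF, hfF⟩ := hf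
  exact ⟨S, F, hF.mono (Set.image_mono h), fun z hz => hfF z (h hz)⟩

theorem IsDiffFunOf.congr {n : ℕ∞ω} {U : Set (Jet N α)} {f g : Jet N α → ℝ}
    (hf : IsDiffFunOf n U f) (h : Set.EqOn g f U) : IsDiffFunOf n U g := by
  obtain ⟨S, F, hF, hfF⟩ := hf
  exact ⟨S, F, hF, fun z hz => (h hz).trans (hfF z hz)⟩

/-- Finitely many differential functions depend on a common finite set of jet coordinates. -/
theorem exists_common {n : ℕ∞ω} {U : Set (Jet N α)} {ι : Type} [Finite ι] {f : ι → Jet N α → ℝ}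
    (hf : ∀ k, IsDiffFunOf n U (f k)) : ∃ S, ∀ k, IsDiffFunIn n S U (f k) := by
  classical
  have := Fintype.ofFinite ι
  choose S hS using hf
  exact ⟨Finset.univ.biUnion S, fun k =>
    (hS k).mono (Finset.subset_biUnion_of_mem S (Finset.mem_univ k))⟩

/-- A `Cⁿ` function of finitely many differential functions is a differential function. -/
theorem IsDiffFunOf.comp_contDiffOn {n : ℕ∞ω} {U : Set (Jet N α)} {ι : Type} [Fintype ι]
    {f : ι → Jet N α → ℝ} (hf : ∀ k, IsDiffFunOf n U (f k)) {Φ : (ι → ℝ) → ℝ} {Y : Set (ι → ℝ)}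
    (hΦ : ContDiffOn ℝ n Φ Y) (hY : ∀ z ∈ U, (fun k => f k z) ∈ Y) :
    IsDiffFunOf n U (fun z => Φ (fun k => f k z)) := by
  obtain ⟨S, hS⟩ := exists_common hf
  choose F hF hfF using hS
  refine ⟨S, fun p => Φ (fun k => F k p), hΦ.comp (contDiffOn_pi.2 fun k => hF k) ?_, ?_⟩
  · rintro _ ⟨z, hz, rfl⟩
    have := hY z hz
    simpa only [hfF _ z hz] using this
  · intro z hz
    simp only [hfF _ z hz]

theorem IsDiffFunOf.const {n : ℕ∞ω} {U : Set (Jet N α)} (c : ℝ) :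
    IsDiffFunOf n U (fun _ => c) :=
  ⟨∅, fun _ => c, contDiffOn_const, fun _ _ => rfl⟩

theorem IsDiffFunOf.coord {n : ℕ∞ω} {U : Set (Jet N α)} (a : α) (J : MultiIndex N) :
    IsDiffFunOf n U (fun z => z.2 a J) := by
  classical
  refine ⟨{(a, J)}, fun p => p.2 ⟨(a, J), by simp⟩, ContDiff.contDiffOn (by fun_prop), ?_⟩
  exact fun _ _ => rfl

theorem IsDiffFunOf.base {n : ℕ∞ω} {U : Set (Jet N α)} {X : Set (Fin N → ℝ)}
    {h : (Fin N → ℝ) → ℝ} (hh : ContDiffOn ℝ n h X) (hU : ∀ z ∈ U, z.1 ∈ X) :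
    IsDiffFunOf n U (fun z => h z.1) := by
  refine ⟨∅, fun p => h p.1, hh.comp contDiff_fst.contDiffOn ?_, fun _ _ => rfl⟩
  rintro _ ⟨z, hz, rfl⟩
  exact hU z hz

theorem IsDiffFunOf.add {n : ℕ∞ω} {U : Set (Jet N α)} {f g : Jet N α → ℝ}
    (hf : IsDiffFunOf n U f) (hg : IsDiffFunOf n U g) : IsDiffFunOf n U (fun z => f z + g z) := by
  have h : ∀ k : Bool, IsDiffFunOf n U (if k then f else g) := by
    rintro (_ | _) <;> simpa
  have hΦ : ContDiffOn ℝ n (fun y : Bool → ℝ => y true + y false) Set.univ :=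
    ContDiff.contDiffOn (by fun_prop)
  simpa using IsDiffFunOf.comp_contDiffOn h hΦ (fun _ _ => Set.mem_univ _)

theorem IsDiffFunOf.mul {n : ℕ∞ω} {U : Set (Jet N α)} {f g : Jet N α → ℝ}
    (hf : IsDiffFunOf n U f) (hg : IsDiffFunOf n U g) : IsDiffFunOf n U (fun z => f z * g z) := by
  have h : ∀ k : Bool, IsDiffFunOf n U (if k then f else g) := by
    rintro (_ | _) <;> simpa
  have hΦ : ContDiffOn ℝ n (fun y : Bool → ℝ => y true * y false) Set.univ :=
    ContDiff.contDiffOn (by fun_prop)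
  simpa using IsDiffFunOf.comp_contDiffOn h hΦ (fun _ _ => Set.mem_univ _)

theorem IsDiffFunOf.neg {n : ℕ∞ω} {U : Set (Jet N α)} {f : Jet N α → ℝ}
    (hf : IsDiffFunOf n U f) : IsDiffFunOf n U (fun z => -f z) := by
  simpa using (IsDiffFunOf.const (-1)).mul hf

theorem IsDiffFunOf.sub {n : ℕ∞ω} {U : Set (Jet N α)} {f g : Jet N α → ℝ}
    (hf : IsDiffFunOf n U f) (hg : IsDiffFunOf n U g) : IsDiffFunOf n U (fun z => f z - g z) := by
  simpa [sub_eq_add_neg] using hf.add hg.neg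

theorem IsDiffFunOf.sum {n : ℕ∞ω} {U : Set (Jet N α)} {ι : Type*} (s : Finset ι)
    {f : ι → Jet N α → ℝ} (hf : ∀ k ∈ s, IsDiffFunOf n U (f k)) :
    IsDiffFunOf n U (fun z => ∑ k ∈ s, f k z) := by
  classical
  induction s using Finset.induction_on with
  | empty => simpa using IsDiffFunOf.const 0
  | insert a s ha ih =>
    simp only [Finset.sum_insert ha]
    exact (hf a (by simp)).add (ih fun k hk => hf k (by simp [hk]))

theorem IsDiffFunOf.finsupp_sum {n : ℕ∞ω} {U : Set (Jet N α)} {ι κ : Type*} [Zero κ] (P : ι →₀ κ)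
    {f : ι → κ → Jet N α → ℝ} (hf : ∀ k, IsDiffFunOf n U (f k (P k))) :
    IsDiffFunOf n U (fun z => P.sum fun k c => f k c z) :=
  IsDiffFunOf.sum _ fun k _ => hf k

/-- Composition of a differential function with a map between jet spaces all of whose
coordinates are differential functions. -/
theorem IsDiffFunOf.comp {n : ℕ∞ω} {U : Set (Jet N α)} {W : Set (Jet N β)} {f : Jet N α → ℝ}
    (hf : IsDiffFunOf n U f) {θ : Jet N β → Jet N α} (hθ : ∀ w ∈ W, θ w ∈ U)
    (h1 : ∀ j, IsDiffFunOf n W (fun w => (θ w).1 j))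
    (h2 : ∀ a J, IsDiffFunOf n W (fun w => (θ w).2 a J)) :
    IsDiffFunOf n W (fun w => f (θ w)) := by
  obtain ⟨S, F, hF, hfF⟩ := hf
  let e : (Fin N ⊕ S → ℝ) → (Fin N → ℝ) × (S → ℝ) := fun y =>
    (fun j => y (Sum.inl j), fun s => y (Sum.inr s))
  have he : ContDiff ℝ n e := by
    refine ContDiff.prodMk ?_ ?_ <;> fun_prop
  let θ' : Fin N ⊕ S → Jet N β → ℝ :=
    Sum.elim (fun j w => (θ w).1 j) (fun s w => (θ w).2 s.1.1 s.1.2)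
  have hθ' : ∀ k, IsDiffFunOf n W (θ' k) := by
    rintro (j | s)
    exacts [h1 j, h2 _ _]
  have hΦ : ContDiffOn ℝ n (fun y => F (e y)) (e ⁻¹' (proj S '' U)) :=
    hF.comp he.contDiffOn fun _ hy => hy
  refine (IsDiffFunOf.comp_contDiffOn hθ' hΦ ?_).congr ?_
  · exact fun w hw => ⟨θ w, hθ w hw, rfl⟩
  · exact fun w hw => hfF _ (hθ w hw)

end Calculus

/-! ### Directional and total derivatives on the infinite jet space. -/

section Derivatives

variable {N : ℕ} {α β : Type} {n : ℕ∞ω}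

/-- Only `n = ∞` and `n = ω` are possible, so differentiation stays in the same class. -/
theorem add_one_le_self_of_infty_le (hn : ∞ ≤ n) : n + 1 ≤ n := by
  cases n with
  | top => exact le_top
  | coe k =>
    have : k = ⊤ := top_le_iff.1 (by exact_mod_cast hn)
    subst this
    exact_mod_cast le_top

theorem ne_zero_of_infty_le (hn : ∞ ≤ n) : n ≠ 0 := by
  rintro rfl
  exact absurd hn (by simp)

theorem eventually_line_mem {U : Set (Jet N α)} (hU : IsOpen U) {z : Jet N α} (hz : z ∈ U)
    (v : Jet N α) : ∀ᶠ t : ℝ in 𝓝 0, z + t • v ∈ U := by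
  have hc : Continuous fun t : ℝ => z + t • v := by fun_prop
  exact hc.continuousAt.preimage_mem_nhds (hU.mem_nhds (by simpa using hz))

theorem lineDeriv_congr_of_eqOn {U : Set (Jet N α)} (hU : IsOpen U) {f g : Jet N α → ℝ}
    (h : Set.EqOn f g U) {z : Jet N α} (hz : z ∈ U) (v : Jet N α) :
    lineDeriv ℝ f z v = lineDeriv ℝ g z v := by
  refine Filter.EventuallyEq.deriv_eq ?_
  filter_upwards [eventually_line_mem hU hz v] with t ht using h ht

theorem hasFDerivAt_of_contDiffOn {U : Set (Jet N α)} (hU : IsOpen U) (hn : n ≠ 0)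
    {S : Finset (α × MultiIndex N)} {F : (Fin N → ℝ) × (S → ℝ) → ℝ}
    (hF : ContDiffOn ℝ n F (proj S '' U)) {z : Jet N α} (hz : z ∈ U) :
    HasFDerivAt F (fderiv ℝ F (proj S z)) (proj S z) :=
  (((hF.contDiffAt ((isOpen_proj_image S hU).mem_nhds ⟨z, hz, rfl⟩))).differentiableAt
    hn).hasFDerivAt

/-- Chain rule along curves that are differentiable in each coordinate. It suffices to differentiate
the finite-dimensional representative `F`, so no differentiable structure on the infinite product is
involved. -/
theorem hasDerivAt_curve_fderiv {U : Set (Jet N α)} (hU : IsOpen U) (hn : n ≠ 0)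
    {f : Jet N α → ℝ} {S : Finset (α × MultiIndex N)} {F : (Fin N → ℝ) × (S → ℝ) → ℝ}
    (hF : ContDiffOn ℝ n F (proj S '' U)) (hfF : ∀ z ∈ U, f z = F (proj S z))
    {c : ℝ → Jet N α} {z c' : Jet N α} (hz : z ∈ U) (hc : c 0 = z)
    (h1 : HasDerivAt (fun t => (c t).1) c'.1 0)
    (h2 : ∀ a J, HasDerivAt (fun t => (c t).2 a J) (c'.2 a J) 0) :
    HasDerivAt (fun t => f (c t)) (fderiv ℝ F (proj S z) (proj S c')) 0 := by
  have hcont : ContinuousAt c 0 := by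
    refine ContinuousAt.prodMk h1.continuousAt ?_
    exact continuousAt_pi.2 fun a => continuousAt_pi.2 fun J => (h2 a J).continuousAt
  have hev : ∀ᶠ t in 𝓝 0, c t ∈ U := hcont.preimage_mem_nhds (hU.mem_nhds (by rwa [hc]))
  have hp : HasDerivAt (fun t => proj S (c t)) (proj S c') 0 :=
    h1.prodMk (hasDerivAt_pi.2 fun s => h2 _ _)
  have hd := hasFDerivAt_of_contDiffOn hU hn hF hz
  rw [← hc] at hd
  have := hd.comp_hasDerivAt (0 : ℝ) hp
  rw [hc] at this
  refine this.congr_of_eventuallyEq ?_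
  filter_upwards [hev] with t ht using hfF _ ht

theorem hasDerivAt_line_fst (z v : Jet N α) : HasDerivAt (fun t : ℝ => (z + t • v).1) v.1 0 := by
  have := ((hasDerivAt_id (0 : ℝ)).smul_const v.1).const_add z.1
  simpa using this

theorem hasDerivAt_line_snd (z v : Jet N α) (a : α) (J : MultiIndex N) :
    HasDerivAt (fun t : ℝ => (z + t • v).2 a J) (v.2 a J) 0 := by
  have := ((hasDerivAt_id (0 : ℝ)).mul_const (v.2 a J)).const_add (z.2 a J)
  simpa using this

theorem lineDeriv_eq_fderiv {U : Set (Jet N α)} (hU : IsOpen U) (hn : n ≠ 0)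
    {f : Jet N α → ℝ} {S : Finset (α × MultiIndex N)} {F : (Fin N → ℝ) × (S → ℝ) → ℝ}
    (hF : ContDiffOn ℝ n F (proj S '' U)) (hfF : ∀ z ∈ U, f z = F (proj S z))
    {z : Jet N α} (hz : z ∈ U) (v : Jet N α) :
    lineDeriv ℝ f z v = fderiv ℝ F (proj S z) (proj S v) :=
  (hasDerivAt_curve_fderiv hU hn hF hfF (c := fun t => z + t • v) hz (by simp)
    (hasDerivAt_line_fst z v) (hasDerivAt_line_snd z v)).deriv

theorem second_fderiv_symm (hn : ∞ ≤ n) {U : Set (Jet N α)} (hU : IsOpen U) {S : Finset (α × MultiIndex N)}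
    {F : (Fin N → ℝ) × (S → ℝ) → ℝ} (hF : ContDiffOn ℝ n F (proj S '' U)) {z : Jet N α} (hz : z ∈ U)
    (p q : (Fin N → ℝ) × (S → ℝ)) :
    fderiv ℝ (fderiv ℝ F) (proj S z) p q = fderiv ℝ (fderiv ℝ F) (proj S z) q p := by
  refine (hF.contDiffAt ((isOpen_proj_image S hU).mem_nhds ⟨z, hz, rfl⟩)).isSymmSndFDerivAt
    ?_ p q
  refine le_trans ?_ hn
  simp only [minSmoothness_of_isRCLikeNormedField]
  exact WithTop.coe_le_coe.2 (le_top : (2 : ℕ∞) ≤ ⊤)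

namespace IsDiffFunOf

variable {U : Set (Jet N α)} {f g : Jet N α → ℝ} {z : Jet N α}

theorem hasDerivAt_curve (hf : IsDiffFunOf n U f) (hn : ∞ ≤ n) (hU : IsOpen U)
    {c : ℝ → Jet N α} {c' : Jet N α} (hz : z ∈ U) (hc : c 0 = z)
    (h1 : HasDerivAt (fun t => (c t).1) c'.1 0)
    (h2 : ∀ a J, HasDerivAt (fun t => (c t).2 a J) (c'.2 a J) 0) :
    HasDerivAt (fun t => f (c t)) (lineDeriv ℝ f z c') 0 := by
  obtain ⟨S, F, hF, hfF⟩ := hf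
  rw [lineDeriv_eq_fderiv hU (ne_zero_of_infty_le hn) hF hfF hz]
  exact hasDerivAt_curve_fderiv hU (ne_zero_of_infty_le hn) hF hfF hz hc h1 h2

theorem hasDerivAt_line (hf : IsDiffFunOf n U f) (hn : ∞ ≤ n) (hU : IsOpen U) (hz : z ∈ U)
    (v : Jet N α) : HasDerivAt (fun t : ℝ => f (z + t • v)) (lineDeriv ℝ f z v) 0 :=
  hf.hasDerivAt_curve hn hU hz (by simp) (hasDerivAt_line_fst z v) (hasDerivAt_line_snd z v)

theorem lineDeriv_add (hf : IsDiffFunOf n U f) (hn : ∞ ≤ n) (hU : IsOpen U) (hz : z ∈ U)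
    (v w : Jet N α) : lineDeriv ℝ f z (v + w) = lineDeriv ℝ f z v + lineDeriv ℝ f z w := by
  obtain ⟨S, F, hF, hfF⟩ := hf
  simp only [lineDeriv_eq_fderiv hU (ne_zero_of_infty_le hn) hF hfF hz]
  exact map_add (fderiv ℝ F (proj S z)) (proj S v) (proj S w)

theorem lineDeriv_smul' (hf : IsDiffFunOf n U f) (hn : ∞ ≤ n) (hU : IsOpen U) (hz : z ∈ U)
    (c : ℝ) (v : Jet N α) : lineDeriv ℝ f z (c • v) = c * lineDeriv ℝ f z v := by
  obtain ⟨S, F, hF, hfF⟩ := hf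
  simp only [lineDeriv_eq_fderiv hU (ne_zero_of_infty_le hn) hF hfF hz]
  exact map_smul (fderiv ℝ F (proj S z)) c (proj S v)

theorem lineDeriv_sum (hf : IsDiffFunOf n U f) (hn : ∞ ≤ n) (hU : IsOpen U) (hz : z ∈ U)
    {ι : Type*} (s : Finset ι) (v : ι → Jet N α) :
    lineDeriv ℝ f z (∑ k ∈ s, v k) = ∑ k ∈ s, lineDeriv ℝ f z (v k) := by
  classical
  induction s using Finset.induction_on with
  | empty => simpa using hf.lineDeriv_smul' hn hU hz 0 0
  | insert a s ha ih => rw [Finset.sum_insert ha, Finset.sum_insert ha, ← ih,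
      hf.lineDeriv_add hn hU hz]

theorem lineDeriv_const (hf : IsDiffFunOf n U f) (hn : ∞ ≤ n) (hU : IsOpen U) (v : Jet N α) :
    IsDiffFunOf n U (fun z => lineDeriv ℝ f z v) := by
  obtain ⟨S, F, hF, hfF⟩ := hf
  refine ⟨S, fun p => fderiv ℝ F p (proj S v), ?_, fun z hz =>
    lineDeriv_eq_fderiv hU (ne_zero_of_infty_le hn) hF hfF hz v⟩
  exact (hF.fderiv_of_isOpen (isOpen_proj_image S hU)
    (add_one_le_self_of_infty_le hn)).clm_apply contDiffOn_const

end IsDiffFunOf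

/-- The direction at `z` along which the total derivative `D_i` differentiates. -/
def shift (i : Fin N) (z : Jet N α) : Jet N α :=
  (Pi.single i 1, fun a J => z.2 a (J + Pi.single i 1))

/-- The linear part of `shift`. -/
def shiftLin (i : Fin N) (z : Jet N α) : Jet N α :=
  (0, fun a J => z.2 a (J + Pi.single i 1))

theorem shift_add_smul (i : Fin N) (z v : Jet N α) (t : ℝ) :
    shift i (z + t • v) = shift i z + t • shiftLin i v := by
  refine Prod.ext ?_ rfl
  simp [shift, shiftLin]

theorem shiftLin_shift_comm (i j : Fin N) (z : Jet N α) :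
    shiftLin i (shift j z) = shiftLin j (shift i z) := by
  refine Prod.ext rfl (funext fun a => funext fun J => ?_)
  simp [shift, shiftLin, add_right_comm]

section

variable [DecidableEq α] {U : Set (Jet N α)} {f g : Jet N α → ℝ} {z : Jet N α}

theorem pdu_eq_zero_of_notMem (hU : IsOpen U) {S : Finset (α × MultiIndex N)}
    (hf : IsDiffFunIn n S U f) (hz : z ∈ U) {a : α} {J : MultiIndex N} (h : (a, J) ∉ S) :
    pdu a J f z = 0 := by
  obtain ⟨F, hF, hfF⟩ := hf
  have he : ∀ t : ℝ, proj S (z + t • ((0, Pi.single a (Pi.single J 1)) : Jet N α)) = proj S z := by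
    intro t
    rw [proj_add_smul]
    refine Prod.ext (by simp [proj]) (funext fun s => ?_)
    have hs : s.1 ≠ (a, J) := fun e => h (e ▸ s.2)
    by_cases ha : s.1.1 = a
    · have hJ : s.1.2 ≠ J := fun e => hs (Prod.ext ha e)
      simp [proj, ha, Pi.single_eq_of_ne hJ]
    · simp [proj, Pi.single_eq_of_ne ha]
  have : (fun t : ℝ => f (z + t • ((0, Pi.single a (Pi.single J 1)) : Jet N α)))
      =ᶠ[𝓝 0] fun _ => F (proj S z) := by
    filter_upwards [eventually_line_mem hU hz _] with t ht
    rw [hfF _ ht, he]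
  rw [pdu, lineDeriv, this.deriv_eq, deriv_const]

/-- The derivative in an arbitrary direction, expanded in jet coordinates. -/
theorem lineDeriv_eq_sum (hn : ∞ ≤ n) (hU : IsOpen U) {S : Finset (α × MultiIndex N)}
    (hf : IsDiffFunIn n S U f) (hz : z ∈ U) (v : Jet N α) :
    lineDeriv ℝ f z v = lineDeriv ℝ f z (v.1, 0) + ∑ p ∈ S, v.2 p.1 p.2 * pdu p.1 p.2 f z := by
  have hf' : IsDiffFunOf n U f := ⟨S, hf⟩
  have e : ∀ p ∈ S, v.2 p.1 p.2 * pdu p.1 p.2 f z = lineDeriv ℝ f z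
      (v.2 p.1 p.2 • ((0, Pi.single p.1 (Pi.single p.2 1)) : Jet N α)) := fun p _ => by
    rw [hf'.lineDeriv_smul' hn hU hz, pdu]
  rw [Finset.sum_congr rfl e, ← hf'.lineDeriv_sum hn hU hz, ← hf'.lineDeriv_add hn hU hz]
  obtain ⟨F, hF, hfF⟩ := hf
  simp only [lineDeriv_eq_fderiv hU (ne_zero_of_infty_le hn) hF hfF hz]
  congr 1
  refine Prod.ext ?_ (funext fun s => ?_)
  · simp [proj, Prod.fst_sum]
  · simp only [proj, Prod.snd_add, Pi.add_apply, Prod.snd_sum, Finset.sum_apply,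
      Prod.smul_snd, Pi.smul_apply, smul_eq_mul, Pi.zero_apply, zero_add]
    rw [Finset.sum_eq_single s.1]
    · simp
    · intro p _ hp
      by_cases ha : s.1.1 = p.1
      · have hJ : s.1.2 ≠ p.2 := fun e => hp (Prod.ext ha e).symm
        rw [ha]
        simp [Pi.single_eq_of_ne hJ]
      · simp [Pi.single_eq_of_ne ha]
    · exact fun h => absurd s.2 h

theorem totalD_eq_sum (hU : IsOpen U) {S : Finset (α × MultiIndex N)}
    (hf : IsDiffFunIn n S U f) (hz : z ∈ U) (i : Fin N) :
    totalD i f z = pdx i f z + ∑ p ∈ S, z.2 p.1 (p.2 + Pi.single i 1) * pdu p.1 p.2 f z := by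
  rw [totalD, finsum_eq_sum_of_support_subset]
  intro p hp
  by_contra h
  exact hp (by simp [pdu_eq_zero_of_notMem hU hf hz h])

/-- This replaces the sum over jet coordinates by a derivative along one vector, so that the sum and
product rules and commutation reduce to ordinary calculus. -/
theorem totalD_eq_lineDeriv (hf : IsDiffFunOf n U f) (hn : ∞ ≤ n) (hU : IsOpen U) (hz : z ∈ U)
    (i : Fin N) : totalD i f z = lineDeriv ℝ f z (shift i z) := by
  obtain ⟨S, hS⟩ := hf
  rw [totalD_eq_sum hU hS hz, lineDeriv_eq_sum hn hU hS hz]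
  rfl

theorem totalD_eqOn (hU : IsOpen U) (i : Fin N) (h : Set.EqOn f g U) :
    Set.EqOn (totalD i f) (totalD i g) U := by
  intro z hz
  simp only [totalD, pdx, pdu, lineDeriv_congr_of_eqOn hU h hz]

theorem IsDiffFunOf.pdu (hf : IsDiffFunOf n U f) (hn : ∞ ≤ n) (hU : IsOpen U) (a : α)
    (J : MultiIndex N) : IsDiffFunOf n U (pdu a J f) := hf.lineDeriv_const hn hU _

theorem IsDiffFunOf.totalD (hf : IsDiffFunOf n U f) (hn : ∞ ≤ n) (hU : IsOpen U) (i : Fin N) :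
    IsDiffFunOf n U (totalD i f) := by
  obtain ⟨S, hS⟩ := id hf
  refine ((hf.lineDeriv_const hn hU (Pi.single i 1, 0)).add (IsDiffFunOf.sum S fun p _ =>
    (IsDiffFunOf.coord p.1 (p.2 + Pi.single i 1)).mul (hf.pdu hn hU p.1 p.2))).congr ?_
  exact fun z hz => totalD_eq_sum hU hS hz i

/-- The derivative of a total derivative. -/
theorem lineDeriv_totalD (hn : ∞ ≤ n) (hU : IsOpen U) {S : Finset (α × MultiIndex N)}
    {F : (Fin N → ℝ) × (S → ℝ) → ℝ} (hF : ContDiffOn ℝ n F (proj S '' U))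
    (hfF : ∀ z ∈ U, f z = F (proj S z)) (hz : z ∈ U) (i : Fin N) (v : Jet N α) :
    lineDeriv ℝ (totalD i f) z v =
      fderiv ℝ (fderiv ℝ F) (proj S z) (proj S v) (proj S (shift i z)) +
        fderiv ℝ F (proj S z) (proj S (shiftLin i v)) := by
  have hn0 := ne_zero_of_infty_le hn
  have ho := isOpen_proj_image S hU
  have hF' : ContDiffOn ℝ n (fderiv ℝ F) (proj S '' U) :=
    hF.fderiv_of_isOpen ho (add_one_le_self_of_infty_le hn)
  have hd : HasFDerivAt (fderiv ℝ F) (fderiv ℝ (fderiv ℝ F) (proj S z)) (proj S z) :=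
    ((hF'.contDiffAt (ho.mem_nhds ⟨z, hz, rfl⟩)).differentiableAt hn0).hasFDerivAt
  have hline : ∀ p q : (Fin N → ℝ) × (S → ℝ), HasDerivAt (fun t : ℝ => p + t • q) q 0 := by
    intro p q
    simpa using ((hasDerivAt_id (0 : ℝ)).smul_const q).const_add p
  have h1 : HasDerivAt (fun t : ℝ => fderiv ℝ F (proj S z + t • proj S v))
      (fderiv ℝ (fderiv ℝ F) (proj S z) (proj S v)) 0 := by
    refine HasFDerivAt.comp_hasDerivAt (0 : ℝ) (l := fderiv ℝ F) ?_ (hline _ _)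
    simpa using hd
  -- Both the base point and the direction `shift i` move along the line; the product rule yields
  -- one term for each.
  have h2 := h1.clm_apply (hline (proj S (shift i z)) (proj S (shiftLin i v)))
  have hev : (fun t : ℝ => totalD i f (z + t • v)) =ᶠ[𝓝 0] fun t =>
      fderiv ℝ F (proj S z + t • proj S v)
        (proj S (shift i z) + t • proj S (shiftLin i v)) := by
    filter_upwards [eventually_line_mem hU hz v] with t ht
    rw [totalD_eq_lineDeriv ⟨S, F, hF, hfF⟩ hn hU ht, lineDeriv_eq_fderiv hU hn0 hF hfF ht,
      shift_add_smul]
    rfl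
  rw [lineDeriv, hev.deriv_eq, h2.deriv]
  simp

/-- The two orders differ by exchanging the arguments of the second derivative of `F` and by
exchanging the two index shifts; both expressions are symmetric. -/
theorem totalD_comm (hf : IsDiffFunOf n U f) (hn : ∞ ≤ n) (hU : IsOpen U) (i j : Fin N) :
    Set.EqOn (totalD i (totalD j f)) (totalD j (totalD i f)) U := by
  intro z hz
  rw [totalD_eq_lineDeriv (hf.totalD hn hU j) hn hU hz,
    totalD_eq_lineDeriv (hf.totalD hn hU i) hn hU hz]
  obtain ⟨S, F, hF, hfF⟩ := hf
  rw [lineDeriv_totalD hn hU hF hfF hz, lineDeriv_totalD hn hU hF hfF hz,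
    second_fderiv_symm hn hU hF hz, shiftLin_shift_comm]

/-- The commutator of a total derivative with the derivative in a fixed direction. -/
theorem lineDeriv_totalD_eq (hf : IsDiffFunOf n U f) (hn : ∞ ≤ n) (hU : IsOpen U) (hz : z ∈ U)
    (i : Fin N) (v : Jet N α) :
    lineDeriv ℝ (totalD i f) z v =
      totalD i (fun y => lineDeriv ℝ f y v) z + lineDeriv ℝ f z (shiftLin i v) := by
  rw [totalD_eq_lineDeriv (hf.lineDeriv_const hn hU v) hn hU hz]
  obtain ⟨S, F, hF, hfF⟩ := hf
  have hn0 := ne_zero_of_infty_le hn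
  have ho := isOpen_proj_image S hU
  have hF' : ContDiffOn ℝ n (fderiv ℝ F) (proj S '' U) :=
    hF.fderiv_of_isOpen ho (add_one_le_self_of_infty_le hn)
  have hd : HasFDerivAt (fderiv ℝ F) (fderiv ℝ (fderiv ℝ F) (proj S z)) (proj S z) :=
    ((hF'.contDiffAt (ho.mem_nhds ⟨z, hz, rfl⟩)).differentiableAt hn0).hasFDerivAt
  rw [lineDeriv_totalD hn hU hF hfF hz, lineDeriv_eq_fderiv hU hn0 hF hfF hz,
    second_fderiv_symm hn hU hF hz]
  congr 1
  rw [lineDeriv_eq_fderiv hU hn0 (F := fun p => fderiv ℝ F p (proj S v))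
    (hF'.clm_apply contDiffOn_const) (fun y hy => lineDeriv_eq_fderiv hU hn0 hF hfF hy v) hz]
  have := (hd.clm_apply (hasFDerivAt_const (proj S v) (proj S z))).fderiv
  rw [this]
  simp

theorem totalD_add (hf : IsDiffFunOf n U f) (hg : IsDiffFunOf n U g) (hn : ∞ ≤ n) (hU : IsOpen U)
    (i : Fin N) (hz : z ∈ U) :
    totalD i (fun y => f y + g y) z = totalD i f z + totalD i g z := by
  rw [totalD_eq_lineDeriv (hf.add hg) hn hU hz, totalD_eq_lineDeriv hf hn hU hz,
    totalD_eq_lineDeriv hg hn hU hz]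
  exact ((hf.hasDerivAt_line hn hU hz _).add (hg.hasDerivAt_line hn hU hz _)).deriv

theorem totalD_mul (hf : IsDiffFunOf n U f) (hg : IsDiffFunOf n U g) (hn : ∞ ≤ n) (hU : IsOpen U)
    (i : Fin N) (hz : z ∈ U) :
    totalD i (fun y => f y * g y) z = totalD i f z * g z + f z * totalD i g z := by
  rw [totalD_eq_lineDeriv (hf.mul hg) hn hU hz, totalD_eq_lineDeriv hf hn hU hz,
    totalD_eq_lineDeriv hg hn hU hz]
  have := ((hf.hasDerivAt_line hn hU hz (shift i z)).mul
    (hg.hasDerivAt_line hn hU hz (shift i z))).deriv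
  simp only [zero_smul, add_zero] at this
  exact this

theorem totalD_const (c : ℝ) (i : Fin N) (z : Jet N α) : totalD i (fun _ => c) z = 0 := by
  simp [totalD, pdx, pdu, lineDeriv]

theorem totalD_neg (f : Jet N α → ℝ) (i : Fin N) (z : Jet N α) :
    totalD i (fun y => -f y) z = -totalD i f z := by
  have h : ∀ v, lineDeriv ℝ (fun y => -f y) z v = -lineDeriv ℝ f z v := fun v => deriv.fun_neg
  simp only [totalD, pdx, pdu, h, mul_neg, finsum_neg_distrib, neg_add]

theorem totalDs_eqOn (hU : IsOpen U) (K : MultiIndex N) (h : Set.EqOn f g U) :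
    Set.EqOn (totalDs K f) (totalDs K g) U :=
  multiPow_eqOn (fun i _ _ => totalD_eqOn hU i) K h

theorem IsDiffFunOf.totalDs (hf : IsDiffFunOf n U f) (hn : ∞ ≤ n) (hU : IsOpen U)
    (K : MultiIndex N) : IsDiffFunOf n U (totalDs K f) :=
  multiPow_mem (P := IsDiffFunOf n U) (fun i _ h => h.totalD hn hU i) K hf

theorem totalDs_totalD (hf : IsDiffFunOf n U f) (hn : ∞ ≤ n) (hU : IsOpen U) (K : MultiIndex N)
    (i : Fin N) : Set.EqOn (totalDs K (totalD i f)) (totalD i (totalDs K f)) U :=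
  multiPow_comm_eqOn (P := IsDiffFunOf n U) (fun i _ h => h.totalD hn hU i)
    (fun i _ _ => totalD_eqOn hU i) (fun i j _ h => totalD_comm h hn hU i j) K i hf

theorem totalDs_add_single (hf : IsDiffFunOf n U f) (hn : ∞ ≤ n) (hU : IsOpen U)
    (K : MultiIndex N) (i : Fin N) :
    Set.EqOn (totalDs (K + Pi.single i 1) f) (totalD i (totalDs K f)) U :=
  multiPow_add_single (P := IsDiffFunOf n U) (fun i _ h => h.totalD hn hU i)
    (fun i _ _ => totalD_eqOn hU i) (fun i j _ h => totalD_comm h hn hU i j) K i hf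

theorem totalDs_zero (f : Jet N α → ℝ) : totalDs 0 f = f := multiPow_zero _ _

theorem totalDs_add (hf : IsDiffFunOf n U f) (hg : IsDiffFunOf n U g) (hn : ∞ ≤ n)
    (hU : IsOpen U) (K : MultiIndex N) (hz : z ∈ U) :
    totalDs K (fun y => f y + g y) z = totalDs K f z + totalDs K g z := by
  induction K using multiIndex_induction generalizing z with
  | h0 => simp only [totalDs_zero]
  | hs K i ih =>
    rw [totalDs_add_single (hf.add hg) hn hU K i hz, totalDs_add_single hf hn hU K i hz,
      totalDs_add_single hg hn hU K i hz, ← totalD_add (hf.totalDs hn hU K) (hg.totalDs hn hU K)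
        hn hU i hz]
    exact totalD_eqOn hU i (fun y hy => ih hy) hz

theorem totalDs_neg (f : Jet N α → ℝ) (K : MultiIndex N) :
    totalDs K (fun y => -f y) = fun z => -totalDs K f z := by
  have := multiPow_intertwine (N := N) (W' := Set.univ) (D := totalD (α := α)) (D' := totalD)
    (P := fun _ => True)
    (fun f y => -f y) (fun _ _ _ => trivial) (fun i f g h => by
      rw [Set.eqOn_univ] at h; rw [h]; exact fun _ _ => rfl)
    (fun i f _ z _ => totalD_neg f i z) K (f := f) trivial
  exact Set.eqOn_univ _ _ |>.1 this

theorem totalDs_const_zero (K : MultiIndex N) : totalDs K (fun _ : Jet N α => (0 : ℝ)) = 0 := by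
  have := totalDs_neg (fun _ : Jet N α => (0 : ℝ)) K
  funext z
  have h := congrFun this z
  simp only [neg_zero] at h
  rw [Pi.zero_apply]
  linarith

theorem totalDs_sum {ι : Type*} (s : Finset ι) {f : ι → Jet N α → ℝ}
    (hf : ∀ k ∈ s, IsDiffFunOf n U (f k)) (hn : ∞ ≤ n) (hU : IsOpen U) (K : MultiIndex N)
    (hz : z ∈ U) : totalDs K (fun y => ∑ k ∈ s, f k y) z = ∑ k ∈ s, totalDs K (f k) z := by
  classical
  induction s using Finset.induction_on with
  | empty => simp [totalDs_const_zero]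
  | insert a s ha ih =>
    simp only [Finset.sum_insert ha]
    rw [totalDs_add (hf a (by simp)) (IsDiffFunOf.sum s fun k hk => hf k (by simp [hk])) hn hU K hz,
      ih fun k hk => hf k (by simp [hk])]

theorem totalDs_const_mul (hf : IsDiffFunOf n U f) (hn : ∞ ≤ n) (hU : IsOpen U) (c : ℝ)
    (K : MultiIndex N) (hz : z ∈ U) : totalDs K (fun y => c * f y) z = c * totalDs K f z := by
  induction K using multiIndex_induction generalizing z with
  | h0 => simp only [totalDs_zero]
  | hs K i ih =>
    have hc : IsDiffFunOf n U (fun _ => c) := IsDiffFunOf.const c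
    rw [totalDs_add_single (hc.mul hf) hn hU K i hz, totalDs_add_single hf hn hU K i hz,
      totalD_eqOn hU i (fun y hy => ih hy) hz, totalD_mul hc (hf.totalDs hn hU K) hn hU i hz,
      totalD_const]
    ring

theorem IsDiffFunOf.negDs (hf : IsDiffFunOf n U f) (hn : ∞ ≤ n) (hU : IsOpen U)
    (K : MultiIndex N) : IsDiffFunOf n U (negDs K f) :=
  (IsDiffFunOf.const _).mul (hf.totalDs hn hU K)

theorem negDs_eqOn (hU : IsOpen U) (K : MultiIndex N) (h : Set.EqOn f g U) :
    Set.EqOn (negDs K f) (negDs K g) U := fun z hz => by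
  simp only [negDs, totalDs_eqOn hU K h hz]

theorem negDs_zero (f : Jet N α → ℝ) : negDs 0 f = f := by
  funext z
  simp [negDs, totalDs_zero]

theorem sum_add_single (K : MultiIndex N) (i : Fin N) :
    ∑ j, (K + Pi.single i 1 : MultiIndex N) j = ∑ j, K j + 1 := by
  simp [Finset.sum_add_distrib]

theorem negDs_add_single (hf : IsDiffFunOf n U f) (hn : ∞ ≤ n) (hU : IsOpen U)
    (K : MultiIndex N) (i : Fin N) (hz : z ∈ U) :
    negDs (K + Pi.single i 1) f z = -negDs K (totalD i f) z := by
  simp only [negDs, sum_add_single, totalDs_add_single hf hn hU K i hz,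
    totalDs_totalD hf hn hU K i hz]
  ring

theorem negDs_neg (f : Jet N α → ℝ) (K : MultiIndex N) (z : Jet N α) :
    negDs K (fun y => -f y) z = -negDs K f z := by
  simp [negDs, totalDs_neg]

theorem negDs_sum {ι : Type*} (s : Finset ι) {f : ι → Jet N α → ℝ}
    (hf : ∀ k ∈ s, IsDiffFunOf n U (f k)) (hn : ∞ ≤ n) (hU : IsOpen U) (K : MultiIndex N)
    (hz : z ∈ U) : negDs K (fun y => ∑ k ∈ s, f k y) z = ∑ k ∈ s, negDs K (f k) z := by
  simp only [negDs, totalDs_sum s hf hn hU K hz, Finset.mul_sum]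

theorem negDs_add (hf : IsDiffFunOf n U f) (hg : IsDiffFunOf n U g) (hn : ∞ ≤ n)
    (hU : IsOpen U) (K : MultiIndex N) (hz : z ∈ U) :
    negDs K (fun y => f y + g y) z = negDs K f z + negDs K g z := by
  simp only [negDs, totalDs_add hf hg hn hU K hz, mul_add]

end

end Derivatives

/-! ### Differential functions that involve only some of the dependent variables. -/

section Reindex

variable {N : ℕ} {α β : Type} {n : ℕ∞ω}

/-- The map of jet spaces that pulls the dependent variables back along `e`. -/
def reindex (e : α → β) (w : Jet N β) : Jet N α := (w.1, fun a => w.2 (e a))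

theorem continuous_reindex (e : α → β) : Continuous (reindex (N := N) e) := by
  unfold reindex
  fun_prop

theorem IsDiffFunOf.reindex {U : Set (Jet N α)} {f : Jet N α → ℝ} (hf : IsDiffFunOf n U f)
    (e : α → β) : IsDiffFunOf n (ConsLaw.reindex e ⁻¹' U) (fun w => f (ConsLaw.reindex e w)) :=
  hf.comp (fun _ hw => hw)
    (fun j => IsDiffFunOf.base (X := Set.univ) (h := fun x => x j)
      (ContDiff.contDiffOn (by fun_prop)) (fun _ _ => Set.mem_univ _))
    (fun a J => IsDiffFunOf.coord (e a) J)

variable [DecidableEq α] [DecidableEq β]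

theorem totalD_reindex (hn : ∞ ≤ n) {U : Set (Jet N α)} (hU : IsOpen U) {f : Jet N α → ℝ}
    (hf : IsDiffFunOf n U f) (e : α → β) (i : Fin N) :
    Set.EqOn (totalD i (fun w => f (reindex e w))) (fun w => totalD i f (reindex e w))
      (reindex e ⁻¹' U) := by
  intro w hw
  change totalD i (fun w => f (reindex e w)) w = totalD i f (reindex e w)
  rw [totalD_eq_lineDeriv (hf.reindex e) hn (hU.preimage (continuous_reindex e)) hw,
    totalD_eq_lineDeriv hf hn hU hw]
  rfl

theorem totalDs_reindex (hn : ∞ ≤ n) {U : Set (Jet N α)} (hU : IsOpen U) {f : Jet N α → ℝ}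
    (hf : IsDiffFunOf n U f) (e : α → β) (K : MultiIndex N) :
    Set.EqOn (totalDs K (fun w => f (reindex e w))) (fun w => totalDs K f (reindex e w))
      (reindex e ⁻¹' U) :=
  multiPow_intertwine (P := IsDiffFunOf n U) (fun f w => f (reindex e w))
    (fun i _ h => h.totalD hn hU i)
    (fun i _ _ => totalD_eqOn (hU.preimage (continuous_reindex e)) i)
    (fun i _ h => totalD_reindex hn hU h e i) K hf

end Reindex

theorem isOpen_base {N : ℕ} {α : Type} {V : Set (Fin N → ℝ)} (hV : IsOpen V) :
    IsOpen {z : Jet N α | z.1 ∈ V} := hV.preimage continuous_fst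

/-! ### Functions of `x` alone, and their partial derivatives. -/

section Base

variable {N : ℕ} {α : Type} [DecidableEq α] {n : ℕ∞ω}

theorem totalD_base (h : (Fin N → ℝ) → ℝ) (i : Fin N) (z : Jet N α) :
    totalD i (fun z : Jet N α => h z.1) z = lineDeriv ℝ h z.1 (Pi.single i 1) := by
  have : ∀ a J, pdu a J (fun z : Jet N α => h z.1) z = 0 := by
    intro a J
    simp [pdu, lineDeriv]
  simp only [totalD, this, mul_zero, finsum_zero, add_zero]
  rfl

theorem totalDs_base (h : (Fin N → ℝ) → ℝ) (K : MultiIndex N) (z : Jet N α) :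
    totalDs K (fun z : Jet N α => h z.1) z = xDeriv K h z.1 :=
  multiPow_intertwine (P := fun _ => True) (W' := Set.univ)
    (fun (h : (Fin N → ℝ) → ℝ) (z : Jet N α) => h z.1) (fun _ _ _ => trivial)
    (fun i f g hfg => by rw [Set.eqOn_univ] at hfg; rw [hfg]; exact fun _ _ => rfl)
    (fun i f _ z _ => totalD_base f i z) K trivial (Set.mem_univ z)

theorem contDiffOn_xDeriv (hn : ∞ ≤ n) {V : Set (Fin N → ℝ)} (hV : IsOpen V)
    {g : (Fin N → ℝ) → ℝ} (hg : ContDiffOn ℝ n g V) (J : MultiIndex N) :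
    ContDiffOn ℝ n (xDeriv J g) V := by
  refine multiPow_mem (P := fun h => ContDiffOn ℝ n h V) (fun i h hh => ?_) J hg
  refine ContDiffOn.congr ((hh.fderiv_of_isOpen hV
    (add_one_le_self_of_infty_le hn)).clm_apply (contDiffOn_const (c := Pi.single i 1))) fun x hx => ?_
  rw [((hh.contDiffAt (hV.mem_nhds hx)).differentiableAt
    (ne_zero_of_infty_le hn)).lineDeriv_eq_fderiv]

/-- A function of `x` is a differential function on the jet space without dependent variables, where
total derivatives are partial derivatives. The rule is thus inherited from `totalDs_add_single`. -/
theorem xDeriv_add_single (hn : ∞ ≤ n) {V : Set (Fin N → ℝ)} (hV : IsOpen V)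
    {g : (Fin N → ℝ) → ℝ} (hg : ContDiffOn ℝ n g V) (J : MultiIndex N) (i : Fin N)
    {x : Fin N → ℝ} (hx : x ∈ V) :
    xDeriv (J + Pi.single i 1) g x = lineDeriv ℝ (xDeriv J g) x (Pi.single i 1) := by
  have hf : IsDiffFunOf n {z : Jet N Empty | z.1 ∈ V} (fun z => g z.1) :=
    IsDiffFunOf.base hg fun _ hz => hz
  have h := totalDs_add_single hf hn (isOpen_base hV) J i (x := (x, 0)) hx
  have e : totalDs J (fun z : Jet N Empty => g z.1) = fun z => xDeriv J g z.1 :=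
    funext fun z => totalDs_base g J z
  rwa [totalDs_base, e, totalD_base] at h

theorem xDeriv_zero_fun (J : MultiIndex N) : xDeriv J (fun _ => 0) = fun _ => 0 := by
  funext x
  have := totalDs_base (α := Empty) (fun _ => 0) J (x, 0)
  rw [totalDs_const_zero] at this
  exact this.symm

theorem xDeriv_const_mul (hn : ∞ ≤ n) {V : Set (Fin N → ℝ)} (hV : IsOpen V)
    {g : (Fin N → ℝ) → ℝ} (hg : ContDiffOn ℝ n g V) (c : ℝ) (J : MultiIndex N)
    {x : Fin N → ℝ} (hx : x ∈ V) : xDeriv J (fun y => c * g y) x = c * xDeriv J g x := by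
  have hf : IsDiffFunOf n {z : Jet N Empty | z.1 ∈ V} (fun z => g z.1) :=
    IsDiffFunOf.base hg fun _ hz => hz
  have h := totalDs_const_mul hf hn (isOpen_base hV) c J (z := (x, 0)) hx
  rwa [totalDs_base (fun y => c * g y), totalDs_base] at h

end Base

/-! ### Inserting functions `g(x)` into functions of `(x,[u],[g])`. -/

section Plug

variable {N M R : ℕ} {n : ℕ∞ω}

theorem isOpen_cyl {U : Set (Jet N (Fin M))} (hU : IsOpen U) : IsOpen (cyl R U) :=
  hU.preimage (continuous_reindex _)

theorem extend_mem_cyl {U : Set (Jet N (Fin M))} {z : Jet N (Fin M)} (hz : z ∈ U)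
    (γ : Fin R → MultiIndex N → ℝ) : extend z γ ∈ cyl R U := hz

theorem isOpen_over {U : Set (Jet N (Fin M))} (hU : IsOpen U) {V : Set (Fin N → ℝ)}
    (hV : IsOpen V) : IsOpen {z ∈ U | z.1 ∈ V} := hU.inter (isOpen_base hV)

variable {U : Set (Jet N (Fin M))} {C : Jet N (Fin M ⊕ Fin R) → ℝ} {V : Set (Fin N → ℝ)}
  {g : Fin R → (Fin N → ℝ) → ℝ}

theorem IsDiffFunOf.plug (hn : ∞ ≤ n) (hC : IsDiffFunOf n (cyl R U) C) (hV : IsOpen V)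
    (hg : ∀ r, ContDiffOn ℝ n (g r) V) :
    IsDiffFunOf n {z ∈ U | z.1 ∈ V} (plug C g) := by
  refine hC.comp (W := {z ∈ U | z.1 ∈ V}) (θ := fun z => extend z (jetOf g z.1))
    (fun z hz => extend_mem_cyl hz.1 _) (fun j => ?_) ?_
  · exact IsDiffFunOf.base (X := Set.univ) (h := fun x => x j)
      (ContDiff.contDiffOn (by fun_prop)) (fun _ _ => Set.mem_univ _)
  · rintro (a | r) J
    · exact IsDiffFunOf.coord a J
    · exact IsDiffFunOf.base (contDiffOn_xDeriv hn hV (hg r) J) fun _ hz => hz.2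

/-- Inserting functions `g(x)` commutes with total derivatives. -/
theorem totalD_plug (hn : ∞ ≤ n) (hU : IsOpen U) (hC : IsDiffFunOf n (cyl R U) C) (hV : IsOpen V)
    (hg : ∀ r, ContDiffOn ℝ n (g r) V) (i : Fin N) :
    Set.EqOn (totalD i (plug C g)) (plug (totalD i C) g) {z ∈ U | z.1 ∈ V} := by
  intro z hz
  rw [totalD_eq_lineDeriv (hC.plug hn hV hg) hn (isOpen_over hU hV) hz, ConsLaw.plug,
    totalD_eq_lineDeriv hC hn (isOpen_cyl hU) (extend_mem_cyl hz.1 _)]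
  -- The line along `shift i z` lifts to a curve, in general not straight, on which the
  -- `g`-coordinates are the jets of `g`. Its velocity is `shift i` at the lifted point because `∂_i
  -- g^r_J = g^r_{J+1_i}`.
  refine HasDerivAt.deriv (hC.hasDerivAt_curve hn (isOpen_cyl hU)
    (c := fun t : ℝ => extend (z + t • shift i z) (jetOf g (z + t • shift i z).1))
    (extend_mem_cyl hz.1 _) (by simp) (hasDerivAt_line_fst z (shift i z)) ?_)
  rintro (a | r) J
  · exact hasDerivAt_line_snd z (shift i z) a J
  · change HasDerivAt (fun t : ℝ => xDeriv J (g r) (z.1 + t • Pi.single i 1))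
      (xDeriv (J + Pi.single i 1) (g r) z.1) 0
    rw [xDeriv_add_single hn hV (hg r) J i hz.2]
    have hd : DifferentiableAt ℝ (xDeriv J (g r)) z.1 :=
      ((contDiffOn_xDeriv hn hV (hg r) J).contDiffAt (hV.mem_nhds hz.2)).differentiableAt
        (ne_zero_of_infty_le hn)
    rw [hd.lineDeriv_eq_fderiv]
    exact hd.hasFDerivAt.hasLineDerivAt _

/-- Evaluation at `[g] = 0` is the insertion of `g = 0`, so it inherits the rules for insertion. -/
theorem plug_zero (C : Jet N (Fin M ⊕ Fin R) → ℝ) :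
    plug C (fun _ _ => 0) = fun z => C (extend z 0) := by
  have : ∀ x, jetOf (ρ := Fin R) (fun _ (_ : Fin N → ℝ) => (0 : ℝ)) x = 0 := by
    intro x
    funext r J
    simp [jetOf, xDeriv_zero_fun]
  funext z
  simp [plug, this]

theorem IsDiffFunOf.extend_zero (hn : ∞ ≤ n) (hC : IsDiffFunOf n (cyl R U) C) :
    IsDiffFunOf n U (fun z => C (extend z 0)) := by
  have := hC.plug (g := fun _ _ => 0) hn isOpen_univ (fun _ => contDiffOn_const)
  simpa [plug_zero] using this

theorem totalD_extend_zero (hn : ∞ ≤ n) (hU : IsOpen U) (hC : IsDiffFunOf n (cyl R U) C)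
    (i : Fin N) : Set.EqOn (totalD i (fun z => C (extend z 0)))
      (fun z => totalD i C (extend z 0)) U := by
  have := totalD_plug (g := fun _ _ => 0) hn hU hC isOpen_univ (fun _ => contDiffOn_const) i
  simpa [plug_zero] using this

end Plug

/-! ### The Euler operator with respect to `g`, and integration by parts. -/

section Euler

variable {N M R L : ℕ} {n : ℕ∞ω} {U : Set (Jet N (Fin M))} {C G : Jet N (Fin M ⊕ Fin R) → ℝ}

/-- The coefficient `∂C/∂g^r_J` at `[g] = 0`. -/
def gCoeff (C : Jet N (Fin M ⊕ Fin R) → ℝ) (r : Fin R) (J : MultiIndex N)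
    (y : Jet N (Fin M)) : ℝ := pdu (Sum.inr r) J C (extend y 0)

theorem IsDiffFunOf.gCoeff (hC : IsDiffFunOf n (cyl R U) C) (hn : ∞ ≤ n) (hU : IsOpen U)
    (r : Fin R) (J : MultiIndex N) : IsDiffFunOf n U (gCoeff C r J) :=
  (hC.pdu hn (isOpen_cyl hU) (Sum.inr r) J).extend_zero hn

theorem gCoeff_eqOn (hU : IsOpen U) (h : Set.EqOn C G (cyl R U)) (r : Fin R) (J : MultiIndex N) :
    Set.EqOn (gCoeff C r J) (gCoeff G r J) U := fun _ hz =>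
  lineDeriv_congr_of_eqOn (isOpen_cyl hU) h (extend_mem_cyl hz 0) _

/-- The multi-indices occurring in a set of jet coordinates. -/
def orders {α : Type} (S : Finset (α × MultiIndex N)) : Finset (MultiIndex N) := S.image Prod.snd

theorem gCoeff_eq_zero (hU : IsOpen U) {S : Finset ((Fin M ⊕ Fin R) × MultiIndex N)}
    (hC : IsDiffFunIn n S (cyl R U) C) {r : Fin R} {J : MultiIndex N} (hJ : J ∉ orders S)
    {z : Jet N (Fin M)} (hz : z ∈ U) : gCoeff C r J z = 0 :=
  pdu_eq_zero_of_notMem (isOpen_cyl hU) hC (extend_mem_cyl hz 0) fun h =>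
    hJ (Finset.mem_image_of_mem Prod.snd h)

theorem negDs_eq_zero {α : Type} [DecidableEq α] {W : Set (Jet N α)} (hW : IsOpen W)
    {f : Jet N α → ℝ} (hf : ∀ z ∈ W, f z = 0) (K : MultiIndex N) {z : Jet N α} (hz : z ∈ W) :
    negDs K f z = 0 := by
  rw [negDs_eqOn hW K (g := fun _ => 0) (fun z hz => hf z hz) hz, negDs, totalDs_const_zero]
  simp

theorem eulerG_eq_sum_of_forall (hU : IsOpen U) (B : Finset (MultiIndex N)) {r : Fin R}
    (hB : ∀ J ∉ B, ∀ z ∈ U, gCoeff C r J z = 0) {z : Jet N (Fin M)} (hz : z ∈ U) :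
    eulerG C r z = ∑ J ∈ B, negDs J (gCoeff C r J) z := by
  rw [eulerG, finsum_eq_sum_of_support_subset]
  · rfl
  · intro J hJ
    by_contra h
    exact hJ (negDs_eq_zero hU (hB J h) J hz)

theorem eulerG_eq_sum (hU : IsOpen U) {S : Finset ((Fin M ⊕ Fin R) × MultiIndex N)}
    (hC : IsDiffFunIn n S (cyl R U) C) {B : Finset (MultiIndex N)} (hB : orders S ⊆ B)
    {r : Fin R} {z : Jet N (Fin M)} (hz : z ∈ U) :
    eulerG C r z = ∑ J ∈ B, negDs J (gCoeff C r J) z :=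
  eulerG_eq_sum_of_forall hU B (fun _ hJ _ hz => gCoeff_eq_zero hU hC (fun h => hJ (hB h)) hz) hz

/-- `eulerG` depends only on the linear part in `[g]`; this allows a function to be replaced by
another one with the same linearization at `[g] = 0`. -/
theorem eulerG_congr (hU : IsOpen U) {r : Fin R}
    (h : ∀ J, Set.EqOn (gCoeff C r J) (gCoeff G r J) U) :
    Set.EqOn (eulerG C r) (eulerG G r) U := fun _ hz =>
  finsum_congr fun J => negDs_eqOn hU J (h J) hz

theorem eulerG_eqOn (hU : IsOpen U) (r : Fin R) (h : Set.EqOn C G (cyl R U)) :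
    Set.EqOn (eulerG C r) (eulerG G r) U := eulerG_congr hU fun J => gCoeff_eqOn hU h r J

theorem gCoeff_add (hn : ∞ ≤ n) (hU : IsOpen U) (hC : IsDiffFunOf n (cyl R U) C)
    (hG : IsDiffFunOf n (cyl R U) G) (r : Fin R) (J : MultiIndex N) {z : Jet N (Fin M)}
    (hz : z ∈ U) : gCoeff (fun w => C w + G w) r J z = gCoeff C r J z + gCoeff G r J z :=
  ((hC.hasDerivAt_line hn (isOpen_cyl hU) (extend_mem_cyl hz 0) _).add
    (hG.hasDerivAt_line hn (isOpen_cyl hU) (extend_mem_cyl hz 0) _)).deriv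

theorem eulerG_add (hn : ∞ ≤ n) (hU : IsOpen U) (hC : IsDiffFunOf n (cyl R U) C)
    (hG : IsDiffFunOf n (cyl R U) G) (r : Fin R) {z : Jet N (Fin M)} (hz : z ∈ U) :
    eulerG (fun w => C w + G w) r z = eulerG C r z + eulerG G r z := by
  obtain ⟨S, hS⟩ := id hC
  obtain ⟨S', hS'⟩ := id hG
  rw [eulerG_eq_sum hU hS (Finset.subset_union_left (s₂ := orders S')) hz,
    eulerG_eq_sum hU hS' (Finset.subset_union_right (s₁ := orders S)) hz,
    eulerG_eq_sum_of_forall hU (orders S ∪ orders S') _ hz, ← Finset.sum_add_distrib]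
  · refine Finset.sum_congr rfl fun J _ => ?_
    rw [negDs_eqOn hU J (fun y hy => gCoeff_add hn hU hC hG r J hy) hz,
      negDs_add (hC.gCoeff hn hU r J) (hG.gCoeff hn hU r J) hn hU J hz]
  · intro J hJ y hy
    rw [Finset.mem_union, not_or] at hJ
    rw [gCoeff_add hn hU hC hG r J hy, gCoeff_eq_zero hU hS hJ.1 hy,
      gCoeff_eq_zero hU hS' hJ.2 hy, add_zero]

theorem eulerG_neg (C : Jet N (Fin M ⊕ Fin R) → ℝ) (r : Fin R) (z : Jet N (Fin M)) :
    eulerG (fun w => -C w) r z = -eulerG C r z := by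
  have h : ∀ J, gCoeff (fun w => -C w) r J = fun y => -gCoeff C r J y := fun J =>
    funext fun y => deriv.fun_neg
  change ∑ᶠ J, negDs J (gCoeff (fun w => -C w) r J) z = -∑ᶠ J, negDs J (gCoeff C r J) z
  simp only [h, negDs_neg, finsum_neg_distrib]

theorem eulerG_zero (hU : IsOpen U) (r : Fin R) {z : Jet N (Fin M)} (hz : z ∈ U) :
    eulerG (fun _ => 0) r z = 0 := by
  rw [eulerG_eq_sum_of_forall hU ∅ _ hz, Finset.sum_empty]
  intro J _ y _
  simp [gCoeff, pdu, lineDeriv]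

theorem eulerG_sum (hn : ∞ ≤ n) (hU : IsOpen U) {ι : Type*} (s : Finset ι)
    {C : ι → Jet N (Fin M ⊕ Fin R) → ℝ} (hC : ∀ k ∈ s, IsDiffFunOf n (cyl R U) (C k))
    (r : Fin R) {z : Jet N (Fin M)} (hz : z ∈ U) :
    eulerG (fun w => ∑ k ∈ s, C k w) r z = ∑ k ∈ s, eulerG (C k) r z := by
  classical
  induction s using Finset.induction_on with
  | empty => simpa using eulerG_zero hU r hz
  | insert a s ha ih =>
    simp only [Finset.sum_insert ha]
    rw [eulerG_add hn hU (hC a (by simp)) (IsDiffFunOf.sum s fun k hk => hC k (by simp [hk])) r hz,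
      ih fun k hk => hC k (by simp [hk])]

theorem shiftLin_single_add {α : Type} [DecidableEq α] (i : Fin N) (a : α) (J : MultiIndex N) :
    shiftLin i ((0, Pi.single a (Pi.single (J + Pi.single i 1) 1)) : Jet N α) =
      (0, Pi.single a (Pi.single J 1)) := by
  refine Prod.ext rfl (funext fun b => funext fun K => ?_)
  by_cases hb : b = a
  · subst hb
    simp [shiftLin, Pi.single_apply]
  · simp [shiftLin, Pi.single_eq_of_ne hb]

theorem shiftLin_single_of_eq_zero {α : Type} [DecidableEq α] (i : Fin N) (a : α)
    (J : MultiIndex N) (hJ : J i = 0) :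
    shiftLin i ((0, Pi.single a (Pi.single J 1)) : Jet N α) = 0 := by
  refine Prod.ext rfl (funext fun b => funext fun K => ?_)
  by_cases hb : b = a
  · subst hb
    have : (K + Pi.single i 1 : MultiIndex N) ≠ J := by
      rintro rfl
      simp at hJ
    simp [shiftLin, Pi.single_eq_of_ne this]
  · simp [shiftLin, Pi.single_eq_of_ne hb]

/-- The commutator of `∂/∂g^r_J` with `D_i` is `∂/∂g^r_{J-1_i}`, or zero if `J i = 0`. The last term
keeps both cases together. -/
theorem gCoeff_totalD (hn : ∞ ≤ n) (hU : IsOpen U) (hC : IsDiffFunOf n (cyl R U) C) (i : Fin N)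
    (r : Fin R) (J : MultiIndex N) {z : Jet N (Fin M)} (hz : z ∈ U) :
    gCoeff (totalD i C) r J z = totalD i (gCoeff C r J) z +
      lineDeriv ℝ C (extend z 0) (shiftLin i (0, Pi.single (Sum.inr r) (Pi.single J 1))) := by
  rw [gCoeff, pdu, lineDeriv_totalD_eq hC hn (isOpen_cyl hU) (extend_mem_cyl hz 0)]
  congr 1
  exact (totalD_extend_zero hn hU (hC.pdu hn (isOpen_cyl hU) (Sum.inr r) J) i hz).symm

theorem gCoeff_totalD_add_single (hn : ∞ ≤ n) (hU : IsOpen U) (hC : IsDiffFunOf n (cyl R U) C)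
    (i : Fin N) (r : Fin R) (J : MultiIndex N) {z : Jet N (Fin M)} (hz : z ∈ U) :
    gCoeff (totalD i C) r (J + Pi.single i 1) z =
      totalD i (gCoeff C r (J + Pi.single i 1)) z + gCoeff C r J z := by
  rw [gCoeff_totalD hn hU hC i r _ hz, shiftLin_single_add]
  rfl

theorem gCoeff_totalD_of_eq_zero (hn : ∞ ≤ n) (hU : IsOpen U) (hC : IsDiffFunOf n (cyl R U) C)
    (i : Fin N) (r : Fin R) (J : MultiIndex N) (hJ : J i = 0) {z : Jet N (Fin M)} (hz : z ∈ U) :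
    gCoeff (totalD i C) r J z = totalD i (gCoeff C r J) z := by
  rw [gCoeff_totalD hn hU hC i r _ hz, shiftLin_single_of_eq_zero _ _ _ hJ]
  simp [lineDeriv]

theorem exists_add_single_of_ne_zero {J : MultiIndex N} {i : Fin N} (h : J i ≠ 0) :
    ∃ K : MultiIndex N, J = K + Pi.single i 1 := by
  refine ⟨J - Pi.single i 1, funext fun j => ?_⟩
  by_cases hj : j = i
  · subst hj; simp; omega
  · simp [Pi.single_eq_of_ne hj]

/-- The Euler operator annihilates total derivatives. -/
theorem eulerG_totalD (hn : ∞ ≤ n) (hU : IsOpen U) (hC : IsDiffFunOf n (cyl R U) C)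
    (i : Fin N) (r : Fin R) {z : Jet N (Fin M)} (hz : z ∈ U) : eulerG (totalD i C) r z = 0 := by
  obtain ⟨S, hS⟩ := id hC
  set c := gCoeff C r with hc
  have hcd : ∀ J, IsDiffFunOf n U (c J) := fun J => hC.gCoeff hn hU r J
  have hc0 : ∀ J ∉ orders S, ∀ z ∈ U, c J z = 0 := fun J hJ z hz => gCoeff_eq_zero hU hS hJ hz
  have hDc0 : ∀ J ∉ orders S, ∀ z ∈ U, totalD i (c J) z = 0 := fun J hJ z hz => by
    rw [totalD_eqOn hU i (g := fun _ => 0) (fun z hz => hc0 J hJ z hz) hz, totalD_const]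
  let s : MultiIndex N → MultiIndex N := fun J => J + Pi.single i 1
  have hs : Function.Injective s := add_left_injective _
  -- The commutator term `∂C/∂g^r_{J-1_i}`. The truncated subtraction is harmful exactly for `J i =
  -- 0`, where the value is set to zero.
  let c' : MultiIndex N → Jet N (Fin M) → ℝ := fun J =>
    if J i = 0 then fun _ => 0 else c (J - Pi.single i 1)
  have hc's : ∀ J, c' (s J) = c J := fun J => by simp [c', s]
  have hc'd : ∀ J, IsDiffFunOf n U (c' J) := fun J => by
    by_cases h : J i = 0
    · simpa [c', h] using IsDiffFunOf.const 0
    · simpa [c', h] using hcd _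
  have hg : ∀ J, ∀ z ∈ U, gCoeff (totalD i C) r J z = totalD i (c J) z + c' J z := by
    intro J z hz
    by_cases h : J i = 0
    · rw [gCoeff_totalD_of_eq_zero hn hU hC i r J h hz]
      simp [c', h, hc]
    · obtain ⟨K, rfl⟩ := exists_add_single_of_ne_zero h
      rw [gCoeff_totalD_add_single hn hU hC i r K hz]
      exact congrArg _ (congrFun (hc's K).symm z)
  have hc'0 : ∀ J ∉ (orders S).image s, ∀ z ∈ U, c' J z = 0 := by
    intro J hJ z hz
    by_cases h : J i = 0
    · simp [c', h]
    · obtain ⟨K, rfl⟩ := exists_add_single_of_ne_zero h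
      rw [show c' (K + Pi.single i 1) = c K from hc's K]
      exact hc0 K (fun hK => hJ (Finset.mem_image_of_mem s hK)) z hz
  rw [eulerG_eq_sum_of_forall hU (orders S ∪ (orders S).image s) _ hz]
  · have e : ∀ J, negDs J (gCoeff (totalD i C) r J) z =
        negDs J (totalD i (c J)) z + negDs J (c' J) z := fun J => by
      rw [negDs_eqOn hU J (fun y hy => hg J y hy) hz,
        negDs_add ((hcd J).totalD hn hU i) (hc'd J) hn hU J hz]
    rw [Finset.sum_congr rfl fun J _ => e J, Finset.sum_add_distrib,
      ← Finset.sum_subset Finset.subset_union_left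
        (fun J _ hJ => negDs_eq_zero hU (hDc0 J hJ) J hz),
      ← Finset.sum_subset Finset.subset_union_right
        (fun J _ hJ => negDs_eq_zero hU (hc'0 J hJ) J hz),
      Finset.sum_image fun _ _ _ _ h => hs h, ← Finset.sum_add_distrib]
    -- After shifting the index of the second family, the terms cancel in pairs: `(-D)_{J+1_i} c_J =
    -- -(-D)_J D_i c_J`.
    refine Finset.sum_eq_zero fun J _ => ?_
    rw [hc's, negDs_add_single (hcd J) hn hU J i hz, add_neg_cancel]
  · intro J hJ y hy
    rw [Finset.mem_union, not_or] at hJ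
    rw [hg J y hy, hDc0 J hJ.1 y hy, hc'0 J hJ.2 y hy, add_zero]

/-- Integration by parts under the Euler operator. -/
theorem eulerG_mul_totalD (hn : ∞ ≤ n) (hU : IsOpen U) {b : Jet N (Fin M) → ℝ}
    (hb : IsDiffFunOf n U b) (hC : IsDiffFunOf n (cyl R U) C) (i : Fin N) (r : Fin R)
    {z : Jet N (Fin M)} (hz : z ∈ U) :
    eulerG (fun w => b (reindex Sum.inl w) * totalD i C w) r z =
      -eulerG (fun w => totalD i b (reindex Sum.inl w) * C w) r z := by
  have hb' : IsDiffFunOf n (cyl R U) (fun w => b (reindex Sum.inl w)) := hb.reindex Sum.inl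
  have hDb' : IsDiffFunOf n (cyl R U) (fun w => totalD i b (reindex Sum.inl w)) :=
    (hb.totalD hn hU i).reindex Sum.inl
  have h := eulerG_totalD hn hU (hb'.mul hC) i r hz
  have e : Set.EqOn (totalD i fun w => b (reindex Sum.inl w) * C w)
      (fun w => totalD i b (reindex Sum.inl w) * C w + b (reindex Sum.inl w) * totalD i C w)
      (cyl R U) := fun w hw => by
    rw [totalD_mul hb' hC hn (isOpen_cyl hU) i hw,
      totalD_reindex hn hU hb (Sum.inl : Fin M → Fin M ⊕ Fin R) i hw]
  rw [eulerG_eqOn hU r e hz, eulerG_add hn hU (hDb'.mul hC)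
    (hb'.mul (hC.totalD hn (isOpen_cyl hU) i)) r hz] at h
  linarith

theorem eulerG_mul_totalDs (hn : ∞ ≤ n) (hU : IsOpen U) {b : Jet N (Fin M) → ℝ}
    (hb : IsDiffFunOf n U b) (hC : IsDiffFunOf n (cyl R U) C) (K : MultiIndex N) (r : Fin R)
    {z : Jet N (Fin M)} (hz : z ∈ U) :
    eulerG (fun w => b (reindex Sum.inl w) * totalDs K C w) r z =
      eulerG (fun w => negDs K b (reindex Sum.inl w) * C w) r z := by
  induction K using multiIndex_induction generalizing b with
  | h0 => simp only [totalDs_zero, negDs_zero]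
  | hs K i ih =>
    have e : Set.EqOn (fun w => b (reindex Sum.inl w) * totalDs (K + Pi.single i 1) C w)
        (fun w => b (reindex Sum.inl w) * totalD i (totalDs K C) w) (cyl R U) := fun w hw => by
      simp only [totalDs_add_single hC hn (isOpen_cyl hU) K i hw]
    have e' : Set.EqOn (fun w => negDs (K + Pi.single i 1) b (reindex Sum.inl w) * C w)
        (fun w => -(negDs K (totalD i b) (reindex Sum.inl w) * C w)) (cyl R U) := fun w hw => by
      simp only [negDs_add_single hb hn hU K i (show reindex Sum.inl w ∈ U from hw), neg_mul]
    rw [eulerG_eqOn hU r e hz, eulerG_mul_totalD hn hU hb (hC.totalDs hn (isOpen_cyl hU) K) i r hz,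
      ih (hb.totalD hn hU i), eulerG_eqOn hU r e' hz, eulerG_neg]

theorem constraint_single (d : Fin L → Fin R → MultiIndex N →₀ ((Fin N → ℝ) → ℝ)) (l : Fin L)
    (x : Fin N → ℝ) (r : Fin R) (J : MultiIndex N) :
    constraint d l (x, Pi.single r (Pi.single J 1)) = d l r J x := by
  rw [constraint, Finset.sum_eq_single r]
  · simp only [Pi.single_eq_same]
    rw [Finsupp.sum, Finset.sum_eq_single J]
    · simp
    · intro K _ hK
      simp [Pi.single_eq_of_ne hK]
    · intro h
      simp [Finsupp.notMem_support_iff.1 h]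
  · intro s _ hs
    simp [Pi.single_eq_of_ne hs]
  · simp

theorem constraint_lin (d : Fin L → Fin R → MultiIndex N →₀ ((Fin N → ℝ) → ℝ)) (l : Fin L)
    (x : Fin N → ℝ) (c : ℝ) (γ γ' : Fin R → MultiIndex N → ℝ) :
    constraint d l (x, c • γ + γ') = c * constraint d l (x, γ) + constraint d l (x, γ') := by
  simp only [constraint, Finsupp.sum, Finset.mul_sum, ← Finset.sum_add_distrib]
  refine Finset.sum_congr rfl fun r _ => Finset.sum_congr rfl fun J _ => ?_
  simp only [Pi.add_apply, Pi.smul_apply, smul_eq_mul]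
  ring

theorem extend_line (z : Jet N (Fin M)) (t : ℝ) (γ : Fin R → MultiIndex N → ℝ) :
    extend z 0 + t • ((0, Sum.elim (0 : Fin M → MultiIndex N → ℝ) γ) : Jet N (Fin M ⊕ Fin R)) = extend z (t • γ) := by
  refine Prod.ext (by simp [extend]) (funext fun a => ?_)
  rcases a with a | r
  · simp [extend]
  · simp [extend]

theorem single_inr (r : Fin R) (J : MultiIndex N) :
    (Pi.single (Sum.inr r) (Pi.single J 1) : Fin M ⊕ Fin R → MultiIndex N → ℝ) =
      Sum.elim (0 : Fin M → MultiIndex N → ℝ) (Pi.single r (Pi.single J 1)) := by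
  funext a
  rcases a with a | s
  · rw [Pi.single_eq_of_ne (by simp)]
    rfl
  · by_cases h : s = r
    · subst h
      simp
    · have h' : (Sum.inr s : Fin M ⊕ Fin R) ≠ Sum.inr r := fun e => h (Sum.inr.inj e)
      simp [Pi.single_eq_of_ne h, Pi.single_eq_of_ne h']

/-- A function linear on a line through the origin equals its own derivative there. -/
theorem gCoeff_of_homogeneous {r : Fin R} {J : MultiIndex N} {z : Jet N (Fin M)}
    (h : ∀ t : ℝ, C (extend z (t • (Pi.single r (Pi.single J 1) : Fin R → MultiIndex N → ℝ))) =
      t * C (extend z (Pi.single r (Pi.single J 1)))) :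
    gCoeff C r J z = C (extend z (Pi.single r (Pi.single J 1))) := by
  rw [gCoeff, pdu, lineDeriv, single_inr]
  simp only [extend_line, h]
  simp

theorem constraint_zero (d : Fin L → Fin R → MultiIndex N →₀ ((Fin N → ℝ) → ℝ)) (l : Fin L)
    (x : Fin N → ℝ) : constraint d l (x, 0) = 0 := by simp [constraint]

theorem constraint_smul (d : Fin L → Fin R → MultiIndex N →₀ ((Fin N → ℝ) → ℝ)) (l : Fin L)
    (x : Fin N → ℝ) (c : ℝ) (γ : Fin R → MultiIndex N → ℝ) :
    constraint d l (x, c • γ) = c * constraint d l (x, γ) := by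
  simpa [constraint_zero] using constraint_lin d l x c γ 0

theorem gCoeff_mul_constraint (d : Fin L → Fin R → MultiIndex N →₀ ((Fin N → ℝ) → ℝ)) (l : Fin L)
    (b : Jet N (Fin M) → ℝ) (r : Fin R) (J : MultiIndex N) (z : Jet N (Fin M)) :
    gCoeff (fun w : Jet N (Fin M ⊕ Fin R) =>
      b (reindex Sum.inl w) * constraint d l (reindex Sum.inr w)) r J z = d l r J z.1 * b z := by
  have e : ∀ γ : Fin R → MultiIndex N → ℝ,
      b (reindex Sum.inl (extend z γ)) * constraint d l (reindex Sum.inr (extend z γ)) =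
        b z * constraint d l (z.1, γ) := fun γ => rfl
  rw [gCoeff_of_homogeneous, e, constraint_single, mul_comm]
  intro t
  rw [e, e, constraint_smul]
  ring

theorem eulerG_mul_constraint (hU : IsOpen U)
    (d : Fin L → Fin R → MultiIndex N →₀ ((Fin N → ℝ) → ℝ)) (l : Fin L)
    (b : Jet N (Fin M) → ℝ) (r : Fin R) {z : Jet N (Fin M)} (hz : z ∈ U) :
    eulerG (fun w : Jet N (Fin M ⊕ Fin R) =>
      b (reindex Sum.inl w) * constraint d l (reindex Sum.inr w)) r z =
      adjointOp (d l r) b z := by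
  have e := fun J => funext (gCoeff_mul_constraint d l b r J)
  rw [eulerG_eq_sum_of_forall hU (d l r).support _ hz, adjointOp, Finsupp.sum]
  · exact Finset.sum_congr rfl fun J _ => by rw [e]
  · intro J hJ y _
    rw [e, Finsupp.notMem_support_iff.1 hJ]
    simp

end Euler

/-! ### Generalized inverses that depend analytically on the matrix. -/

section PseudoInverse

open Matrix

theorem analyticAt_matrix_mul {N : ℕ} {S S' S'' : Type} [Fintype S'] {A : (Fin N → ℝ) → Matrix S S' ℝ}
    {B : (Fin N → ℝ) → Matrix S' S'' ℝ} {x : Fin N → ℝ}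
    (hA : ∀ a b, AnalyticAt ℝ (fun y => A y a b) x) (hB : ∀ a b, AnalyticAt ℝ (fun y => B y a b) x)
    (a : S) (b : S'') : AnalyticAt ℝ (fun y => (A y * B y) a b) x := by
  simp only [mul_apply]
  exact Finset.analyticAt_fun_sum _ fun c _ => (hA a c).mul (hB c b)

variable {T S : Type} [Fintype T] [DecidableEq T] [Fintype S]

/-- If `k` is the multiplicity of the eigenvalue `0` of a real symmetric matrix `B`, this is a
generalized inverse of `B`, given by a formula that is rational in the entries of `B`. -/
def genInv (k : ℕ) (B : Matrix T T ℝ) : Matrix T T ℝ :=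
  -(B.charpoly.coeff k)⁻¹ •
    ∑ j ∈ Finset.range (Fintype.card T + 1), B.charpoly.coeff (k + 1 + j) • B ^ j

/-- The multiplicity of `0` as a root of the characteristic polynomial of a symmetric matrix is
its corank. -/
theorem exists_charpoly_eq {B : Matrix T T ℝ} (hB : B.IsHermitian) :
    ∃ Q : Polynomial ℝ, B.charpoly = Q * Polynomial.X ^ (Fintype.card T - B.rank) ∧
      Q.coeff 0 ≠ 0 := by
  refine ⟨∏ i with hB.eigenvalues i ≠ 0, (Polynomial.X - Polynomial.C (hB.eigenvalues i)),
    ?_, ?_⟩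
  · rw [hB.charpoly_eq, ← Finset.prod_filter_mul_prod_filter_not Finset.univ
      (fun i => hB.eigenvalues i ≠ 0)]
    congr 1
    have e : ∀ i ∈ Finset.univ.filter (fun i => ¬hB.eigenvalues i ≠ 0),
        (Polynomial.X - Polynomial.C ((hB.eigenvalues i : ℝ) : ℝ)) = Polynomial.X := by
      intro i hi
      have : hB.eigenvalues i = 0 := by simpa using hi
      simp [this]
    have hc := Finset.card_filter_add_card_filter_not (s := (Finset.univ : Finset T))
      (fun i => hB.eigenvalues i ≠ 0)
    refine (Finset.prod_congr rfl e).trans ?_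
    rw [Finset.prod_const]
    congr 1
    rw [hB.rank_eq_card_non_zero_eigs, Fintype.card_subtype, ← Finset.card_univ, ← hc,
      Nat.add_sub_cancel_left]
  · rw [Polynomial.coeff_zero_eq_eval_zero, Polynomial.eval_prod]
    refine Finset.prod_ne_zero_iff.2 fun i hi => ?_
    simpa using (Finset.mem_filter.1 hi).2

/-- For symmetric `B`, `B B Z = 0` means `Bᵀ B Z = 0`, which forces `B Z = 0` over the reals. The
exponent therefore descends to one. -/
theorem mul_eq_zero_of_pow_mul_eq_zero {B : Matrix T T ℝ} (hB : B.IsHermitian) (k : ℕ)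
    {Y : Matrix T T ℝ} (h : B ^ k * Y = 0) : B * Y = 0 := by
  induction k with
  | zero => rw [pow_zero, one_mul] at h; rw [h, mul_zero]
  | succ k ih =>
    cases k with
    | zero => simpa using h
    | succ k =>
      refine ih ?_
      rw [pow_succ', pow_succ', ← mul_assoc, Matrix.mul_assoc (B * B)] at h
      have := (conjTranspose_mul_self_mul_eq_zero B (B ^ k * Y)).1 (by rw [hB.eq]; exact h)
      rw [pow_succ', Matrix.mul_assoc]
      exact this

/-- Factor the characteristic polynomial as `X^k Q` with `Q(0) ≠ 0`. Cayley–Hamilton gives `B^k Q(B)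
= 0`, hence `B Q(B) = 0` by symmetry. Writing `Q = X Q₁ + Q(0)` turns this into `B² Q₁(B) = -Q(0)
B`, so `-Q(0)⁻¹ Q₁(B)` is a generalized inverse. -/
theorem mul_genInv_mul {B : Matrix T T ℝ} (hB : B.IsHermitian) :
    B * genInv (Fintype.card T - B.rank) B * B = B := by
  obtain ⟨Q, hQ, hQ0⟩ := exists_charpoly_eq hB
  set k := Fintype.card T - B.rank
  have hcoeff : ∀ j, B.charpoly.coeff (k + j) = Q.coeff j := fun j => by
    rw [hQ, add_comm, Polynomial.coeff_mul_X_pow]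
  -- The fixed summation range in `genInv` covers all coefficients of `Q.divX`; the excess ones are
  -- zero.
  have hdeg : Q.divX.natDegree < Fintype.card T + 1 := by
    have h1 : Q.divX.natDegree ≤ Q.natDegree := by
      rw [Polynomial.natDegree_divX_eq_natDegree_tsub_one]; omega
    have h2 : Q.natDegree ≤ B.charpoly.natDegree := by
      have hQ1 : Q ≠ 0 := by rintro rfl; simp at hQ0
      rw [hQ, Polynomial.natDegree_mul_X_pow _ hQ1]; omega
    rw [B.charpoly_natDegree_eq_dim] at h2
    omega
  set E := Polynomial.aeval B Q.divX with hE
  have hgen : genInv k B = -(Q.coeff 0)⁻¹ • E := by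
    rw [genInv, hE, Polynomial.aeval_eq_sum_range' hdeg, ← hcoeff 0]
    simp only [add_zero]
    congr 1
    refine Finset.sum_congr rfl fun j _ => ?_
    rw [add_assoc, hcoeff, Polynomial.coeff_divX, add_comm]
  have hCH : B ^ k * Polynomial.aeval B Q = 0 := by
    have := B.aeval_self_charpoly
    rw [hQ, mul_comm, map_mul, map_pow, Polynomial.aeval_X] at this
    exact this
  have hBQ := mul_eq_zero_of_pow_mul_eq_zero hB k hCH
  have hcomm : E * B = B * E := by
    have := congrArg (Polynomial.aeval B) (mul_comm Q.divX Polynomial.X)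
    simpa [hE] using this
  have hsplit : Polynomial.aeval B Q = B * E + Q.coeff 0 • 1 := by
    have := congrArg (Polynomial.aeval B) Q.X_mul_divX_add
    rw [← this, map_add, map_mul, Polynomial.aeval_X, Polynomial.aeval_C,
      Algebra.algebraMap_eq_smul_one]
  rw [hsplit, mul_add, Matrix.mul_smul, mul_one] at hBQ
  have h3 : B * (B * E) = -(Q.coeff 0 • B) := eq_neg_of_add_eq_zero_left hBQ
  rw [hgen, Matrix.mul_smul, Matrix.smul_mul, Matrix.mul_assoc, hcomm, h3, smul_neg, smul_smul]
  simp [hQ0]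

/-- A linear form that vanishes on the kernel of `A` is a combination of the rows of `A`, with
coefficients that depend rationally on `A`. -/
theorem vecMul_genInv (A : Matrix T S ℝ) (h : S → ℝ)
    (hh : ∀ γ, A *ᵥ γ = 0 → h ⬝ᵥ γ = 0) :
    (h ᵥ* (Aᵀ * genInv (Fintype.card T - A.rank) (A * Aᵀ))) ᵥ* A = h := by
  classical
  set G := genInv (Fintype.card T - A.rank) (A * Aᵀ) with hG
  have hB : (A * Aᵀ).IsHermitian := by
    simpa using isHermitian_mul_conjTranspose_self A
  have h1 : A * Aᵀ * G * (A * Aᵀ) = A * Aᵀ := by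
    have := mul_genInv_mul hB
    rwa [rank_self_mul_transpose, ← hG] at this
  -- By `h1` the difference `E` of both sides satisfies `E Aᵀ = 0`. Since `E` has `A` as right
  -- factor, `E Eᵀ = 0`, so `E = 0`.
  have h2 : A * Aᵀ * G * A = A := by
    have h3 : (A * Aᵀ * G * A - A) * (A * Aᵀ * G * A - A)ᴴ = 0 := by
      have e : A * Aᵀ * G * A - A = (A * Aᵀ * G - 1) * A := by
        rw [Matrix.sub_mul, Matrix.one_mul]
      have h4 : (A * Aᵀ * G * A - A) * Aᵀ = 0 := by
        rw [Matrix.sub_mul, Matrix.mul_assoc _ A, h1, sub_self]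
      nth_rw 2 [e]
      rw [conjTranspose_mul, conjTranspose_eq_transpose_of_trivial A, ← Matrix.mul_assoc, h4,
        Matrix.zero_mul]
    exact sub_eq_zero.1 (self_mul_conjTranspose_eq_zero.1 h3)
  have h5 : ∀ γ, h ⬝ᵥ ((Aᵀ * G * A) *ᵥ γ) = h ⬝ᵥ γ := by
    intro γ
    -- By `h2`, `AᵀGA γ - γ` lies in the kernel of `A`, where the form `h` vanishes.
    have h6 := hh ((Aᵀ * G * A) *ᵥ γ - γ) (by
      rw [mulVec_sub, mulVec_mulVec, ← Matrix.mul_assoc, ← Matrix.mul_assoc, h2, sub_self])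
    rwa [dotProduct_sub, sub_eq_zero] at h6
  rw [vecMul_vecMul]
  funext s
  have := h5 (Pi.single s 1)
  rwa [dotProduct_mulVec, dotProduct_single_one, dotProduct_single_one] at this

variable {N : ℕ}

theorem analyticAt_charpoly_coeff {B : (Fin N → ℝ) → Matrix T T ℝ} {x : Fin N → ℝ}
    (hB : ∀ a b, AnalyticAt ℝ (fun y => B y a b) x) (k : ℕ) :
    AnalyticAt ℝ (fun y => (B y).charpoly.coeff k) x := by
  have := AnalyticAt.aeval_mvPolynomial (A := ℝ) (z := x) (f := fun y (p : T × T) => B y p.1 p.2)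
    (fun p => hB p.1 p.2) ((charpoly.univ ℝ T).coeff k)
  refine this.congr (Filter.Eventually.of_forall fun y => ?_)
  exact charpoly.univ_coeff_eval₂Hom T (algebraMap ℝ ℝ) (fun p => B y p.1 p.2) k

theorem analyticAt_matrix_pow {B : (Fin N → ℝ) → Matrix T T ℝ} {x : Fin N → ℝ}
    (hB : ∀ a b, AnalyticAt ℝ (fun y => B y a b) x) (j : ℕ) (a b : T) :
    AnalyticAt ℝ (fun y => (B y ^ j) a b) x := by
  induction j generalizing a b with
  | zero => simpa using analyticAt_const
  | succ j ih =>
    simp only [pow_succ]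
    exact analyticAt_matrix_mul ih hB a b

/-- Constancy of the rank near `x` fixes `k`, so one rational formula holds on a neighbourhood. Its
denominator, the `k`-th coefficient of the characteristic polynomial of `A Aᵀ`, is nonzero at `x`
because `A Aᵀ` has the rank of `A`. -/
theorem analyticAt_genInv {A : (Fin N → ℝ) → Matrix T S ℝ} {x : Fin N → ℝ}
    (hA : ∀ a b, AnalyticAt ℝ (fun y => A y a b) x) (hr : ∀ᶠ y in 𝓝 x, (A y).rank = (A x).rank)
    (s : S) (t : T) : AnalyticAt ℝ (fun y => ((A y)ᵀ *
      genInv (Fintype.card T - (A y).rank) (A y * (A y)ᵀ)) s t) x := by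
  have hB := analyticAt_matrix_mul hA (B := fun y => (A y)ᵀ) fun a b => hA b a
  set k := Fintype.card T - (A x).rank
  have hG : ∀ a b, AnalyticAt ℝ (fun y => genInv k (A y * (A y)ᵀ) a b) x := by
    intro a b
    have hne : (A x * (A x)ᵀ).charpoly.coeff k ≠ 0 := by
      obtain ⟨Q, hQ, hQ0⟩ := exists_charpoly_eq (B := A x * (A x)ᵀ)
        (by simpa using isHermitian_mul_conjTranspose_self (A x))
      rw [rank_self_mul_transpose] at hQ
      have := Polynomial.coeff_mul_X_pow Q k 0
      rw [zero_add] at this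
      rwa [hQ, this]
    simp only [genInv, Matrix.smul_apply, smul_eq_mul, Matrix.sum_apply]
    exact ((analyticAt_charpoly_coeff hB k).inv hne).neg.mul (Finset.analyticAt_fun_sum _ fun j _ =>
      (analyticAt_charpoly_coeff hB _).mul (analyticAt_matrix_pow hB j a b))
  refine (analyticAt_matrix_mul (A := fun y => (A y)ᵀ) (fun a b => hA b a) hG s t).congr ?_
  filter_upwards [hr] with y hy
  rw [hy]

end PseudoInverse

/-! ### The rank of the prolonged constraints as a matrix rank. -/

section Rank

variable {N R L : ℕ}

open Matrix

/-- The rank of finitely many linear forms in `[g]` is the rank of their coefficient matrix. -/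
theorem prolongRank_eq_rank (d : Fin L → Fin R → MultiIndex N →₀ ((Fin N → ℝ) → ℝ))
    (T : Finset (Fin L × MultiIndex N)) (S : Finset (Fin R × MultiIndex N)) (x : Fin N → ℝ)
    (A : Matrix T S ℝ) (hA : ∀ t : T, ∀ γ : Fin R → MultiIndex N → ℝ,
      totalDs t.1.2 (constraint d t.1.1) (x, γ) = ∑ s : S, A t s * γ s.1.1 s.1.2) :
    prolongRank d T x = A.rank := by
  classical
  -- `Ψ` turns row vectors into linear forms in `[g]`. It is injective, since a jet with a single
  -- nonzero coordinate reads off an entry, and so it preserves the dimension of the row space.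
  let Ψ : (S → ℝ) →ₗ[ℝ] ((Fin R → MultiIndex N → ℝ) → ℝ) :=
    { toFun := fun v γ => ∑ s : S, v s * γ s.1.1 s.1.2
      map_add' := fun v w => by
        funext γ
        simp [add_mul, Finset.sum_add_distrib]
      map_smul' := fun c v => by
        funext γ
        simp [Finset.mul_sum, mul_assoc] }
  have hΨ : Function.Injective Ψ := by
    intro v w hvw
    funext s
    have h : ∀ v : S → ℝ, Ψ v (fun r J => if (r, J) = s.1 then 1 else 0) = v s := by
      intro v
      change ∑ s' : S, v s' * (if s'.1 = s.1 then 1 else 0) = v s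
      rw [Finset.sum_eq_single s]
      · simp
      · intro s' _ hs'
        rw [if_neg fun e => hs' (Subtype.ext e), mul_zero]
      · simp
    rw [← h v, ← h w, hvw]
  rw [prolongRank, rank_eq_finrank_span_row]
  have e : ((fun (t : Fin L × MultiIndex N) (γ : Fin R → MultiIndex N → ℝ) =>
      totalDs t.2 (constraint d t.1) (x, γ)) '' (T : Set (Fin L × MultiIndex N))) =
      Ψ '' Set.range A.row := by
    ext f
    constructor
    · rintro ⟨t, ht, rfl⟩
      exact ⟨_, ⟨⟨t, ht⟩, rfl⟩, (funext fun γ => hA ⟨t, ht⟩ γ).symm⟩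
    · rintro ⟨_, ⟨t, rfl⟩, rfl⟩
      exact ⟨t.1, t.2, funext fun γ => hA t γ⟩
  rw [e, Submodule.span_image]
  exact (LinearEquiv.finrank_eq (Submodule.equivMapOfInjective Ψ hΨ _)).symm

end Rank

/-! ### Existence of the multipliers `λ`. -/

section Existence

variable {N M R L : ℕ}

theorem adjointOp_neg {α : Type} [DecidableEq α] (P : MultiIndex N →₀ ((Fin N → ℝ) → ℝ))
    (f : Jet N α → ℝ) (z : Jet N α) :
    adjointOp P (fun y => -f y) z = -adjointOp P f z := by
  simp only [adjointOp, Finsupp.sum, mul_neg, negDs_neg, Finset.sum_neg_distrib]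

theorem adjointOp_sum {α : Type} [DecidableEq α] {n : ℕ∞ω} (hn : ∞ ≤ n) {U : Set (Jet N α)}
    (hU : IsOpen U) {P : MultiIndex N →₀ ((Fin N → ℝ) → ℝ)}
    (hP : ∀ J, IsDiffFunOf n U (fun y => P J y.1)) {ι : Type*} (s : Finset ι)
    {f : ι → Jet N α → ℝ} (hf : ∀ k ∈ s, IsDiffFunOf n U (f k)) {z : Jet N α} (hz : z ∈ U) :
    adjointOp P (fun y => ∑ k ∈ s, f k y) z = ∑ k ∈ s, adjointOp P (f k) z := by
  simp only [adjointOp, Finsupp.sum, Finset.mul_sum]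
  rw [Finset.sum_comm]
  exact Finset.sum_congr rfl fun J _ => negDs_sum s (fun k hk => (hP J).mul (hf k hk)) hn hU J hz

theorem IsDiffFunOf.adjointOp {α : Type} [DecidableEq α] {n : ℕ∞ω} (hn : ∞ ≤ n)
    {U : Set (Jet N α)} (hU : IsOpen U) {P : MultiIndex N →₀ ((Fin N → ℝ) → ℝ)}
    (hP : ∀ J, IsDiffFunOf n U (fun y => P J y.1)) {f : Jet N α → ℝ} (hf : IsDiffFunOf n U f) :
    IsDiffFunOf n U (adjointOp P f) :=
  IsDiffFunOf.finsupp_sum P (f := fun J p z => ConsLaw.negDs J (fun y => p y.1 * f y) z) fun J =>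
    ((hP J).mul hf).negDs hn hU J

/-- `f(x,[g])` is linear in `[g]` at every `x` in `X`. -/
def IsLinearOver (X : Set (Fin N → ℝ)) (f : Jet N (Fin R) → ℝ) : Prop :=
  ∀ x ∈ X, ∀ (c : ℝ) (γ γ' : Fin R → MultiIndex N → ℝ),
    f (x, c • γ + γ') = c * f (x, γ) + f (x, γ')

/-- The direction `shift i` is affine in the jet, with `x`-part independent of it, so the curves for
`γ` and `γ'` combine linearly over the same base point. -/
theorem IsLinearOver.totalD {X : Set (Fin N → ℝ)} (hX : IsOpen X) {n : ℕ∞ω} (hn : ∞ ≤ n)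
    {f : Jet N (Fin R) → ℝ} (hf : IsLinearOver X f) (hfd : IsDiffFunOf n {w | w.1 ∈ X} f)
    (i : Fin N) : IsLinearOver X (totalD i f) := by
  intro x hx c γ γ'
  have hW : IsOpen {w : Jet N (Fin R) | w.1 ∈ X} := isOpen_base hX
  have hd : ∀ γ : Fin R → MultiIndex N → ℝ, HasDerivAt
      (fun t : ℝ => f ((x, γ) + t • shift i (x, γ))) (ConsLaw.totalD i f (x, γ)) 0 := fun γ => by
    rw [totalD_eq_lineDeriv hfd hn hW (show (x, γ) ∈ {w : Jet N (Fin R) | w.1 ∈ X} from hx)]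
    exact hfd.hasDerivAt_line hn hW hx _
  have h := ((hd γ).const_mul c).add (hd γ')
  refine (hd (c • γ + γ')).unique (h.congr_of_eventuallyEq ?_)
  filter_upwards [eventually_line_mem hW (z := (x, γ)) hx (shift i (x, γ))] with t ht
  have e : (x, c • γ + γ') + t • shift i (x, c • γ + γ') = (x + t • Pi.single i 1,
      c • (γ + t • (shift i (x, γ)).2) + (γ' + t • (shift i (x, γ')).2)) := by
    refine Prod.ext rfl (funext fun r => funext fun J => ?_)
    simp [shift]
    ring
  rw [e]
  exact hf (x + t • Pi.single i 1) ht c (γ + t • (shift i (x, γ)).2)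
    (γ' + t • (shift i (x, γ')).2)

theorem IsLinearOver.smul {X : Set (Fin N → ℝ)} {f : Jet N (Fin R) → ℝ} (hf : IsLinearOver X f)
    {x : Fin N → ℝ} (hx : x ∈ X) (c : ℝ) (γ : Fin R → MultiIndex N → ℝ) :
    f (x, c • γ) = c * f (x, γ) := by
  have h0 := hf x hx 1 0 0
  have h := hf x hx c γ 0
  simp only [smul_zero, add_zero, one_mul] at h0 h
  linarith

/-- A linear differential function, expanded in jet coordinates. -/
theorem IsLinearOver.eq_sum {X : Set (Fin N → ℝ)} (hX : IsOpen X) {n : ℕ∞ω} (hn : ∞ ≤ n)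
    {f : Jet N (Fin R) → ℝ} (hf : IsLinearOver X f) {S : Finset (Fin R × MultiIndex N)}
    (hS : IsDiffFunIn n S {w | w.1 ∈ X} f) {x : Fin N → ℝ} (hx : x ∈ X)
    (γ : Fin R → MultiIndex N → ℝ) :
    f (x, γ) = ∑ s ∈ S, f (x, Pi.single s.1 (Pi.single s.2 1)) * γ s.1 s.2 := by
  have hl : ∀ γ : Fin R → MultiIndex N → ℝ, lineDeriv ℝ f (x, 0) (0, γ) = f (x, γ) := by
    intro γ
    have e : ∀ t : ℝ, f ((x, 0) + t • (0, γ)) = t * f (x, γ) := fun t => by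
      rw [← hf.smul hx]
      congr 1
      exact Prod.ext (by simp) (by simp)
    simp only [lineDeriv, e]
    simp
  have h := lineDeriv_eq_sum hn (isOpen_base hX) hS (z := (x, 0)) hx (0, γ)
  rw [hl γ, hl 0] at h
  have h0 : f (x, 0) = 0 := by simpa using hf.smul hx 0 0
  rw [h, h0, zero_add]
  refine Finset.sum_congr rfl fun s _ => ?_
  rw [pdu, hl, mul_comm]

theorem IsDiffFunOf.analyticOnNhd_base {α : Type} {X : Set (Fin N → ℝ)} (hX : IsOpen X)
    {f : Jet N α → ℝ} (hf : IsDiffFunOf ω {w | w.1 ∈ X} f) (γ : α → MultiIndex N → ℝ) :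
    AnalyticOnNhd ℝ (fun x => f (x, γ)) X := by
  obtain ⟨S, F, hF, hfF⟩ := (isDiffFun_iff (isOpen_base hX)).2 hf
  intro x hx
  have h : AnalyticAt ℝ (fun y : Fin N → ℝ => F (y, fun s : S => γ s.1.1 s.1.2)) x :=
    AnalyticAt.fun_comp (hF _ ⟨(x, γ), hx, rfl⟩) (analyticAt_id.prod analyticAt_const)
  refine h.congr ?_
  filter_upwards [hX.mem_nhds hx] with y hy using (hfF (y, γ) hy).symm

theorem isDiffFunOf_base_of_analyticOnNhd {α : Type} {X : Set (Fin N → ℝ)} (hX : IsOpen X)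
    {U : Set (Jet N α)} (hUX : ∀ z ∈ U, z.1 ∈ X) {h : (Fin N → ℝ) → ℝ}
    (hh : AnalyticOnNhd ℝ h X) : IsDiffFunOf ω U (fun z => h z.1) :=
  IsDiffFunOf.base (hh.contDiffOn hX.uniqueDiffOn) hUX

theorem isDiffFunOf_constraint {X : Set (Fin N → ℝ)} (hX : IsOpen X)
    {d : Fin L → Fin R → MultiIndex N →₀ ((Fin N → ℝ) → ℝ)}
    (hd : ∀ l r J, AnalyticOnNhd ℝ (d l r J) X) (l : Fin L) :
    IsDiffFunOf ω {w : Jet N (Fin R) | w.1 ∈ X} (constraint d l) :=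
  IsDiffFunOf.sum _ fun r _ => IsDiffFunOf.finsupp_sum (d l r)
    (f := fun J p w => p w.1 * w.2 r J) fun J =>
      (isDiffFunOf_base_of_analyticOnNhd hX (fun _ hw => hw) (hd l r J)).mul
        (IsDiffFunOf.coord r J)

theorem isLinearOver_totalDs_constraint {X : Set (Fin N → ℝ)} (hX : IsOpen X)
    {d : Fin L → Fin R → MultiIndex N →₀ ((Fin N → ℝ) → ℝ)}
    (hd : ∀ l r J, AnalyticOnNhd ℝ (d l r J) X) (l : Fin L) (K : MultiIndex N) :
    IsLinearOver X (totalDs K (constraint d l)) :=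
  (multiPow_mem (P := fun f => IsDiffFunOf ω {w : Jet N (Fin R) | w.1 ∈ X} f ∧ IsLinearOver X f)
    (fun i _ h => ⟨h.1.totalD le_top (isOpen_base hX) i, h.2.totalD hX le_top h.1 i⟩) K
    ⟨isDiffFunOf_constraint hX hd l, fun x _ c γ γ' => constraint_lin d l x c γ γ'⟩).2

theorem jetOf_const_mul {V : Set (Fin N → ℝ)} (hV : IsOpen V) {g : Fin R → (Fin N → ℝ) → ℝ}
    (hg : ∀ r, ContDiffOn ℝ ∞ (g r) V) (c : ℝ) {x : Fin N → ℝ} (hx : x ∈ V) :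
    jetOf (fun r y => c * g r y) x = c • jetOf g x :=
  funext fun r => funext fun J => xDeriv_const_mul le_rfl hV (hg r) c J hx

theorem IsAdmissible.const_mul {d : Fin L → Fin R → MultiIndex N →₀ ((Fin N → ℝ) → ℝ)}
    {V : Set (Fin N → ℝ)} (hV : IsOpen V) {g : Fin R → (Fin N → ℝ) → ℝ}
    (hg : IsAdmissible d V g) (c : ℝ) : IsAdmissible d V (fun r y => c * g r y) :=
  ⟨fun r => contDiffOn_const.mul (hg.1 r), fun l x hx => by
    rw [jetOf_const_mul hV hg.1 c hx, constraint_smul, hg.2 l x hx, mul_zero]⟩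

/-- The linearization of `H` at `[g] = 0`. -/
theorem lineDeriv_extend_zero {n : ℕ∞ω} (hn : ∞ ≤ n) {U : Set (Jet N (Fin M))} (hU : IsOpen U)
    {H : Jet N (Fin M ⊕ Fin R) → ℝ} {S : Finset ((Fin M ⊕ Fin R) × MultiIndex N)}
    (hS : IsDiffFunIn n S (cyl R U) H) {z : Jet N (Fin M)} (hz : z ∈ U)
    (γ : Fin R → MultiIndex N → ℝ) :
    lineDeriv ℝ H (extend z 0) (0, Sum.elim 0 γ) =
      ∑ r, ∑ J ∈ orders S, gCoeff H r J z * γ r J := by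
  have hS' : IsDiffFunIn n (Finset.univ ×ˢ orders S) (cyl R U) H :=
    hS.mono fun p hp => by
      simp only [Finset.mem_product, Finset.mem_univ, true_and]
      exact Finset.mem_image_of_mem _ hp
  rw [lineDeriv_eq_sum hn (isOpen_cyl hU) hS' (extend_mem_cyl hz 0), Finset.sum_product,
    Fintype.sum_sum_type]
  have h0 : lineDeriv ℝ H (extend z 0) ((0, 0) : Jet N (Fin M ⊕ Fin R)) = 0 := lineDeriv_zero
  simp only [h0, Sum.elim_inl, Sum.elim_inr, Pi.zero_apply, zero_mul, Finset.sum_const_zero,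
    zero_add]
  exact Finset.sum_congr rfl fun r _ => Finset.sum_congr rfl fun J _ => mul_comm _ _

/-- The linear part in `[g]` of `C - D_i F^i` vanishes on the jets of all solutions `g` of the
constraints. -/
theorem linearization_eq_zero_of_admissible {X : Set (Fin N → ℝ)}
    {U : Set (Jet N (Fin M))} (hU : IsOpen U)
    {d : Fin L → Fin R → MultiIndex N →₀ ((Fin N → ℝ) → ℝ)}
    {C : Jet N (Fin M ⊕ Fin R) → ℝ} {F : Fin N → Jet N (Fin M ⊕ Fin R) → ℝ}
    (hF : ∀ i, IsDiffFunOf ω (cyl R U) (F i))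
    (hCF : ∀ (V : Set (Fin N → ℝ)) (g : Fin R → (Fin N → ℝ) → ℝ), IsOpen V → V ⊆ X →
      IsAdmissible d V g → ∀ z ∈ U, z.1 ∈ V → plug C g z = divergence (fun i => plug (F i) g) z)
    {V : Set (Fin N → ℝ)} (hV : IsOpen V) (hVX : V ⊆ X) {g : Fin R → (Fin N → ℝ) → ℝ}
    (hg : IsAdmissible d V g) {z : Jet N (Fin M)} (hz : z ∈ U) (hzV : z.1 ∈ V) :
    lineDeriv ℝ (fun w => C w - ∑ i, totalD i (F i) w) (extend z 0)
      (0, Sum.elim 0 (jetOf g z.1)) = 0 := by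
  -- All multiples `t g` are admissible, so the function vanishes on the whole line through `[g] =
  -- 0` in the direction of the jet of `g`.
  have e : ∀ t : ℝ, C (extend z (t • jetOf g z.1)) -
      ∑ i, totalD i (F i) (extend z (t • jetOf g z.1)) = 0 := by
    intro t
    have hgt := hg.const_mul hV t
    have h := hCF V _ hV hVX hgt z hz hzV
    have hD : ∀ i, totalD i (plug (F i) fun r y => t * g r y) z =
        plug (totalD i (F i)) (fun r y => t * g r y) z := fun i =>
      totalD_plug le_rfl hU ((hF i).of_le le_top) hV hgt.1 i ⟨hz, hzV⟩
    simp only [divergence, hD, plug, jetOf_const_mul hV hg.1 t hzV] at h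
    rw [h, sub_self]
  simp only [lineDeriv, extend_line, e]
  simp

/-- The linear part in `[g]` of a differential function that vanishes on the jets of all solutions
of a complete set of constraints is a combination of finitely many differentiated constraints. -/
theorem exists_combination {X : Set (Fin N → ℝ)} (hX : IsOpen X)
    {U : Set (Jet N (Fin M))} (hU : IsOpen U) (hUX : ∀ z ∈ U, z.1 ∈ X)
    {d : Fin L → Fin R → MultiIndex N →₀ ((Fin N → ℝ) → ℝ)}
    (hd : ∀ l r J, AnalyticOnNhd ℝ (d l r J) X) (hcomplete : IsCompleteSystem d X)
    {H : Jet N (Fin M ⊕ Fin R) → ℝ} (hH : IsDiffFunOf ω (cyl R U) H)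
    (hsol : ∀ (V : Set (Fin N → ℝ)) (g : Fin R → (Fin N → ℝ) → ℝ), IsOpen V → V ⊆ X →
      IsAdmissible d V g → ∀ z ∈ U, z.1 ∈ V →
        lineDeriv ℝ H (extend z 0) (0, Sum.elim 0 (jetOf g z.1)) = 0) :
    ∃ (T : Finset (Fin L × MultiIndex N)) (μ : T → Jet N (Fin M) → ℝ),
      (∀ t, IsDiffFunOf ω U (μ t)) ∧ ∀ r J, ∀ z ∈ U, gCoeff H r J z =
        ∑ t : T, μ t z *
          totalDs t.1.2 (constraint d t.1.1) (z.1, Pi.single r (Pi.single J 1)) := by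
  classical
  obtain ⟨S0, hS0⟩ := id hH
  -- `S1` contains all `g`-coordinates on which `H` depends; completeness is used for these.
  set S1 : Finset (Fin R × MultiIndex N) := Finset.univ ×ˢ orders S0 with hS1
  obtain ⟨T, hrank, hT⟩ := hcomplete S1
  have hld : ∀ t : T, IsDiffFunOf ω {w : Jet N (Fin R) | w.1 ∈ X}
      (totalDs t.1.2 (constraint d t.1.1)) := fun t =>
    (isDiffFunOf_constraint hX hd t.1.1).totalDs le_top (isOpen_base hX) _
  have hll : ∀ t : T, IsLinearOver X (totalDs t.1.2 (constraint d t.1.1)) := fun t =>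
    isLinearOver_totalDs_constraint hX hd _ _
  obtain ⟨S2, hS2⟩ := exists_common hld
  -- The columns of the matrix must also cover the coordinates `S2` that occur in the selected
  -- differentiated constraints.
  set S := S1 ∪ S2 with hS
  let A : (Fin N → ℝ) → Matrix T S ℝ := fun x t s =>
    totalDs t.1.2 (constraint d t.1.1) (x, Pi.single s.1.1 (Pi.single s.1.2 1))
  have hA : ∀ x ∈ X, ∀ t : T, ∀ γ : Fin R → MultiIndex N → ℝ,
      totalDs t.1.2 (constraint d t.1.1) (x, γ) = ∑ s : S, A x t s * γ s.1.1 s.1.2 := by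
    intro x hx t γ
    rw [(hll t).eq_sum hX le_top ((hS2 t).mono (Finset.subset_union_right (s₁ := S1))) hx γ,
      ← Finset.sum_coe_sort]
  have hAan : ∀ x ∈ X, ∀ t s, AnalyticAt ℝ (fun y => A y t s) x := fun x hx t s =>
    (hld t).analyticOnNhd_base hX _ x hx
  have hAr : ∀ x ∈ X, prolongRank d T x = (A x).rank := fun x hx =>
    prolongRank_eq_rank d T S x (A x) (hA x hx)
  have hArank : ∀ x ∈ X, ∀ᶠ y in 𝓝 x, (A y).rank = (A x).rank := fun x hx => by
    filter_upwards [hrank x hx, hX.mem_nhds hx] with y hy hyX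
    rw [← hAr y hyX, ← hAr x hx, hy]
  let h : Jet N (Fin M) → S → ℝ := fun z s => gCoeff H s.1.1 s.1.2 z
  have hzero : ∀ r J, (r, J) ∉ S1 → ∀ z ∈ U, gCoeff H r J z = 0 := fun r J hJ z hz =>
    gCoeff_eq_zero hU hS0 (fun hJ' => hJ (by simp [hS1, hJ'])) hz
  -- A kernel vector, extended by zero, is a jet that satisfies the equations in `T`. The solution
  -- supplied by completeness matches it only on `S1`, which suffices because the coefficients of
  -- `H` vanish outside `S1`.
  have hker : ∀ z ∈ U, ∀ c : S → ℝ, Matrix.mulVec (A z.1) c = 0 → h z ⬝ᵥ c = 0 := by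
    intro z hz c hc
    let γ : Fin R → MultiIndex N → ℝ := fun r J => if hs : (r, J) ∈ S then c ⟨(r, J), hs⟩ else 0
    have hγ : ∀ s : S, γ s.1.1 s.1.2 = c s := fun s => by simp [γ]
    obtain ⟨V, hV, hzV, hVX, g, hg, hgγ⟩ := hT z.1 (hUX z hz) γ (fun t ht => by
      rw [hA z.1 (hUX z hz) ⟨t, ht⟩ γ]
      simp only [hγ]
      exact congrFun hc ⟨t, ht⟩)
    have h1 := hsol V g hV hVX hg z hz hzV
    rw [lineDeriv_extend_zero le_top hU hS0 hz, ← Finset.sum_product'] at h1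
    have h2 : h z ⬝ᵥ c = ∑ s ∈ S, gCoeff H s.1 s.2 z * γ s.1 s.2 := by
      rw [← Finset.sum_coe_sort]
      exact Finset.sum_congr rfl fun s _ => by rw [hγ]
    rw [h2, ← h1, ← Finset.sum_subset (Finset.subset_union_left (s₂ := S2))]
    · exact Finset.sum_congr rfl fun s hs => by rw [hgγ s hs]
    · intro s _ hs
      rw [hzero s.1 s.2 hs z hz, zero_mul]
  let G : (Fin N → ℝ) → Matrix S T ℝ := fun x =>
    (A x).transpose * genInv (Fintype.card T - (A x).rank) (A x * (A x).transpose)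
  have hG : ∀ s t, AnalyticOnNhd ℝ (fun x => G x s t) X := fun s t x hx =>
    analyticAt_genInv (hAan x hx) (hArank x hx) s t
  -- The coefficients of the combination are the row vector `h` times the generalized inverse:
  -- analytic in `x`, and depending on `[u]` only through `h`.
  refine ⟨T, fun t z => ∑ s, h z s * G z.1 s t, fun t => IsDiffFunOf.sum _ fun s _ => ?_, ?_⟩
  · exact (hH.gCoeff le_top hU _ _).mul (isDiffFunOf_base_of_analyticOnNhd hX hUX (hG s t))
  · intro r J z hz
    by_cases hJ : (r, J) ∈ S
    · exact (congrFun (vecMul_genInv (A z.1) (h z) (hker z hz)) ⟨(r, J), hJ⟩).symm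
    · rw [hzero r J (fun hJ' => hJ (Finset.mem_union_left _ hJ')) z hz]
      refine (Finset.sum_eq_zero fun t _ => ?_).symm
      rw [hA z.1 (hUX z hz), Finset.sum_eq_zero, mul_zero]
      intro s _
      have hs : s.1 ≠ (r, J) := fun e => hJ (e ▸ s.2)
      by_cases hr : s.1.1 = r
      · have hsJ : s.1.2 ≠ J := fun e => hs (Prod.ext hr e)
        simp [hr, Pi.single_eq_of_ne hsJ]
      · simp [Pi.single_eq_of_ne hr]

/-- `H` may be replaced by the combination of constraints with the same linear part. Integration by
parts moves `D_K` onto `μ_t`, and the Euler operator of `b 𝒟^l_r g^r` is the adjoint of `𝒟^l_r`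
applied to `b`. -/
theorem eulerG_combination {X : Set (Fin N → ℝ)} (hX : IsOpen X)
    {U : Set (Jet N (Fin M))} (hU : IsOpen U) (hUX : ∀ z ∈ U, z.1 ∈ X)
    {d : Fin L → Fin R → MultiIndex N →₀ ((Fin N → ℝ) → ℝ)}
    (hd : ∀ l r J, AnalyticOnNhd ℝ (d l r J) X)
    {H : Jet N (Fin M ⊕ Fin R) → ℝ} {T : Finset (Fin L × MultiIndex N)}
    {μ : T → Jet N (Fin M) → ℝ} (hμ : ∀ t, IsDiffFunOf ω U (μ t))
    (hHμ : ∀ r J, ∀ z ∈ U, gCoeff H r J z =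
        ∑ t : T, μ t z *
          totalDs t.1.2 (constraint d t.1.1) (z.1, Pi.single r (Pi.single J 1)))
    (r : Fin R) {z : Jet N (Fin M)} (hz : z ∈ U) :
    eulerG H r z = ∑ t : T, adjointOp (d t.1.1 r) (negDs t.1.2 (μ t)) z := by
  have hsub : ∀ w ∈ cyl R U, w ∈ reindex Sum.inr ⁻¹' {w : Jet N (Fin R) | w.1 ∈ X} :=
    fun w hw => hUX _ hw
  have hc : ∀ l, IsDiffFunOf ω (cyl R U) fun w => constraint d l (reindex Sum.inr w) := fun l =>
    ((isDiffFunOf_constraint hX hd l).reindex Sum.inr).mono hsub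
  have hprod : ∀ t : T, Set.EqOn
      (fun w => μ t (reindex Sum.inl w) *
        totalDs t.1.2 (constraint d t.1.1) (reindex Sum.inr w))
      (fun w => μ t (reindex Sum.inl w) *
        totalDs t.1.2 (fun w => constraint d t.1.1 (reindex Sum.inr w)) w) (cyl R U) :=
    fun t w hw => by
      change _ * totalDs t.1.2 (constraint d t.1.1) (reindex Sum.inr w) =
        μ t (reindex Sum.inl w) *
          totalDs t.1.2 (fun w => constraint d t.1.1 (reindex Sum.inr w)) w
      rw [totalDs_reindex le_top (isOpen_base hX) (isDiffFunOf_constraint hX hd t.1.1)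
        (Sum.inr : Fin R → Fin M ⊕ Fin R) t.1.2 (hsub w hw)]
  have hprodd : ∀ t : T, IsDiffFunOf ω (cyl R U) fun w => μ t (reindex Sum.inl w) *
      totalDs t.1.2 (constraint d t.1.1) (reindex Sum.inr w) := fun t =>
    (((hμ t).reindex Sum.inl).mul
      ((hc t.1.1).totalDs le_top (isOpen_cyl hU) t.1.2)).congr (hprod t)
  have e : eulerG H r z = eulerG (fun w => ∑ t : T, μ t (reindex Sum.inl w) *
      totalDs t.1.2 (constraint d t.1.1) (reindex Sum.inr w)) r z := by
    refine eulerG_congr hU (fun J y hy => ?_) hz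
    rw [hHμ r J y hy, gCoeff_of_homogeneous]
    · rfl
    · intro t
      rw [Finset.mul_sum]
      refine Finset.sum_congr rfl fun k _ => ?_
      have := (isLinearOver_totalDs_constraint hX hd k.1.1 k.1.2).smul (hUX y hy) t
        (Pi.single r (Pi.single J 1))
      change μ k y * totalDs k.1.2 (constraint d k.1.1) (y.1, t • Pi.single r (Pi.single J 1)) =
        t * (μ k y * totalDs k.1.2 (constraint d k.1.1) (y.1, Pi.single r (Pi.single J 1)))
      rw [this]
      ring
  rw [e, eulerG_sum le_top hU _ (fun t _ => hprodd t) r hz]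
  refine Finset.sum_congr rfl fun t _ => ?_
  rw [eulerG_eqOn hU r (hprod t) hz, eulerG_mul_totalDs le_top hU (hμ t) (hc _) _ r hz,
    eulerG_mul_constraint hU d _ _ r hz]

theorem exists_isMultiplier {X : Set (Fin N → ℝ)} (hX : IsOpen X)
    {U : Set (Jet N (Fin M))} (hU : IsOpen U) (hUX : ∀ z ∈ U, z.1 ∈ X)
    {d : Fin L → Fin R → MultiIndex N →₀ ((Fin N → ℝ) → ℝ)}
    (hd : ∀ l r J, AnalyticOnNhd ℝ (d l r J) X) (hcomplete : IsCompleteSystem d X)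
    {C : Jet N (Fin M ⊕ Fin R) → ℝ} (hC : IsDiffFunOf ω (cyl R U) C)
    {F : Fin N → Jet N (Fin M ⊕ Fin R) → ℝ} (hF : ∀ i, IsDiffFunOf ω (cyl R U) (F i))
    (hCF : ∀ (V : Set (Fin N → ℝ)) (g : Fin R → (Fin N → ℝ) → ℝ), IsOpen V → V ⊆ X →
      IsAdmissible d V g → ∀ z ∈ U, z.1 ∈ V → plug C g z = divergence (fun i => plug (F i) g) z) :
    ∃ lam : Fin L → Jet N (Fin M) → ℝ, IsMultiplier d U C lam := by
  classical
  have hDF : ∀ i ∈ Finset.univ, IsDiffFunOf ω (cyl R U) (totalD i (F i)) := fun i _ =>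
    (hF i).totalD le_top (isOpen_cyl hU) i
  set H : Jet N (Fin M ⊕ Fin R) → ℝ := fun w => C w - ∑ i, totalD i (F i) w with hH
  have hHd : IsDiffFunOf ω (cyl R U) H := hC.sub (IsDiffFunOf.sum _ hDF)
  obtain ⟨T, μ, hμ, hHμ⟩ := exists_combination hX hU hUX hd hcomplete hHd
    fun V g hV hVX hg z hz hzV =>
      linearization_eq_zero_of_admissible hU hF hCF hV hVX hg hz hzV
  have hneg : ∀ t, IsDiffFunOf ω U (negDs t.1.2 (μ t)) := fun t => (hμ t).negDs le_top hU _
  -- The terms `(-D)_K μ_t` are grouped by the constraint `l` from which they come; the sign moves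
  -- the adjoint to the left-hand side of the equation for `λ`.
  refine ⟨fun l z => -∑ t : T with t.1.1 = l, negDs t.1.2 (μ t) z, fun l => ?_, fun r z hz => ?_⟩
  · exact (isDiffFun_iff hU).2 (IsDiffFunOf.sum _ fun t _ => hneg t).neg
  · have h1 : eulerG C r z = eulerG H r z := by
      have e : C = fun w => H w + ∑ i, totalD i (F i) w := by
        funext w
        simp [hH]
      conv_lhs => rw [e]
      rw [eulerG_add le_top hU hHd (IsDiffFunOf.sum _ hDF) r hz, eulerG_sum le_top hU _ hDF r hz,
        Finset.sum_eq_zero fun i _ => eulerG_totalD le_top hU (hF i) i r hz, add_zero]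
    rw [h1, eulerG_combination hX hU hUX hd hμ hHμ r hz, adjointSum,
      ← Finset.sum_fiberwise Finset.univ (fun t : T => t.1.1), ← Finset.sum_add_distrib]
    refine Finset.sum_eq_zero fun l _ => ?_
    rw [adjointOp_neg, adjointOp_sum le_top hU
      (fun J => isDiffFunOf_base_of_analyticOnNhd hX hUX (hd l r J)) _ (fun t _ => hneg t) hz,
      ← sub_eq_add_neg, sub_eq_zero]
    exact Finset.sum_congr rfl fun t ht => by rw [(Finset.mem_filter.1 ht).2]

end Existence

/-! ### Functions that vanish on shell, and divergences. -/

section OnShell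

variable {N m : ℕ} {α : Type} [DecidableEq α] {n : ℕ∞ω} {A : Fin m → Jet N α → ℝ}
  {W : Set (Jet N α)} {f h : Jet N α → ℝ}

theorem VanishesOnShell.congr (hW : IsOpen W) (hf : VanishesOnShell A W f)
    (hfh : Set.EqOn h f W) : VanishesOnShell A W h := fun z hz hA K => by
  rw [totalDs_eqOn hW K hfh hz, hf z hz hA K]

theorem VanishesOnShell.mono {W' : Set (Jet N α)} (hf : VanishesOnShell A W f) (hW : W' ⊆ W) :
    VanishesOnShell A W' f := fun z hz hA K => hf z (hW hz) hA K

theorem vanishesOnShell_zero : VanishesOnShell A W (fun _ => 0) := fun z _ _ K => by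
  rw [totalDs_const_zero]
  rfl

theorem VanishesOnShell.neg (hf : VanishesOnShell A W f) :
    VanishesOnShell A W (fun z => -f z) := fun z hz hA K => by
  simp only [totalDs_neg, hf z hz hA K, neg_zero]

theorem VanishesOnShell.add (hn : ∞ ≤ n) (hW : IsOpen W) (hf : VanishesOnShell A W f)
    (hh : VanishesOnShell A W h) (hfd : IsDiffFunOf n W f) (hhd : IsDiffFunOf n W h) :
    VanishesOnShell A W (fun z => f z + h z) := fun z hz hA K => by
  rw [totalDs_add hfd hhd hn hW K hz, hf z hz hA K, hh z hz hA K, add_zero]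

theorem VanishesOnShell.sub (hn : ∞ ≤ n) (hW : IsOpen W) (hf : VanishesOnShell A W f)
    (hh : VanishesOnShell A W h) (hfd : IsDiffFunOf n W f) (hhd : IsDiffFunOf n W h) :
    VanishesOnShell A W (fun z => f z - h z) := by
  simpa only [sub_eq_add_neg] using hf.add hn hW hh.neg hfd hhd.neg

theorem VanishesOnShell.sum (hn : ∞ ≤ n) (hW : IsOpen W) {ι : Type*} (s : Finset ι)
    {f : ι → Jet N α → ℝ} (hf : ∀ k ∈ s, VanishesOnShell A W (f k))
    (hfd : ∀ k ∈ s, IsDiffFunOf n W (f k)) :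
    VanishesOnShell A W (fun z => ∑ k ∈ s, f k z) := fun z hz hA K => by
  rw [totalDs_sum s hfd hn hW K hz]
  exact Finset.sum_eq_zero fun k hk => hf k hk z hz hA K

theorem VanishesOnShell.totalD (hn : ∞ ≤ n) (hW : IsOpen W) (hf : VanishesOnShell A W f)
    (hfd : IsDiffFunOf n W f) (i : Fin N) : VanishesOnShell A W (totalD i f) :=
  fun z hz hA K => by
    rw [totalDs_totalD hfd hn hW K i hz, ← totalDs_add_single hfd hn hW K i hz, hf z hz hA _]

/-- All derivatives of the product are required. By the Leibniz rule `D_i(h f)` is a sum of two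
products of the same kind, so the induction on `K` runs over all `f` and `h` at once. -/
theorem VanishesOnShell.mul (hn : ∞ ≤ n) (hW : IsOpen W) (hf : VanishesOnShell A W f)
    (hfd : IsDiffFunOf n W f) (hhd : IsDiffFunOf n W h) :
    VanishesOnShell A W (fun z => h z * f z) := by
  intro z hz hA K
  induction K using multiIndex_induction generalizing f h with
  | h0 =>
    have := hf z hz hA 0
    simp only [totalDs_zero] at this ⊢
    rw [this, mul_zero]
  | hs K i ih =>
    have hDf := hfd.totalD hn hW i
    have hDh := hhd.totalD hn hW i
    rw [totalDs_add_single (hhd.mul hfd) hn hW K i hz,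
      ← totalDs_totalD (hhd.mul hfd) hn hW K i hz,
      totalDs_eqOn hW K (fun y hy => totalD_mul hhd hfd hn hW i hy) hz,
      totalDs_add (hDh.mul hfd) (hhd.mul hDf) hn hW K hz, ih hf hfd hDh,
      ih (hf.totalD hn hW hfd i) hDf hhd, add_zero]

theorem divergence_add (hn : ∞ ≤ n) (hW : IsOpen W) {F G : Fin N → Jet N α → ℝ}
    (hF : ∀ i, IsDiffFunOf n W (F i)) (hG : ∀ i, IsDiffFunOf n W (G i)) {z : Jet N α}
    (hz : z ∈ W) :
    divergence (fun i y => F i y + G i y) z = divergence F z + divergence G z := by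
  simp only [divergence, totalD_add (hF _) (hG _) hn hW _ hz, Finset.sum_add_distrib]

theorem divergence_neg (F : Fin N → Jet N α → ℝ) (z : Jet N α) :
    divergence (fun i y => -F i y) z = -divergence F z := by
  simp only [divergence, totalD_neg, Finset.sum_neg_distrib]

theorem divergence_sub (hn : ∞ ≤ n) (hW : IsOpen W) {F G : Fin N → Jet N α → ℝ}
    (hF : ∀ i, IsDiffFunOf n W (F i)) (hG : ∀ i, IsDiffFunOf n W (G i)) {z : Jet N α}
    (hz : z ∈ W) :
    divergence (fun i y => F i y - G i y) z = divergence F z - divergence G z := by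
  simp only [sub_eq_add_neg]
  rw [divergence_add hn hW hF (fun i => (hG i).neg) hz, divergence_neg]

theorem divergence_zero (z : Jet N α) : divergence (fun _ _ => 0) z = 0 := by
  simp [divergence, totalD_const]

theorem VanishesOnShell.divergence (hn : ∞ ≤ n) (hW : IsOpen W) {F : Fin N → Jet N α → ℝ}
    (hF : ∀ i, VanishesOnShell A W (F i)) (hFd : ∀ i, IsDiffFunOf n W (F i)) :
    VanishesOnShell A W (divergence F) :=
  VanishesOnShell.sum hn hW Finset.univ (fun i _ => (hF i).totalD hn hW (hFd i) i)
    (fun i _ => (hFd i).totalD hn hW i)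

end OnShell

/-! ### Exponentials as test functions that separate derivatives. -/

section Exponential

variable {N : ℕ}

/-- The exponential function `x ↦ exp (ξ · x)`. -/
def expDot (ξ : Fin N → ℝ) (x : Fin N → ℝ) : ℝ := Real.exp (∑ i, ξ i * x i)

theorem contDiff_expDot {n : ℕ∞ω} (ξ : Fin N → ℝ) : ContDiff ℝ n (expDot ξ) := by
  unfold expDot
  exact Real.contDiff_exp.comp (ContDiff.sum fun i _ => contDiff_const.mul (contDiff_apply ℝ ℝ i))

theorem xDeriv_expDot (ξ : Fin N → ℝ) (J : MultiIndex N) :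
    xDeriv J (expDot ξ) = fun x => (∏ i, ξ i ^ J i) * expDot ξ x := by
  induction J using multiIndex_induction with
  | h0 =>
    funext x
    simp [xDeriv, multiPow_zero]
  | hs J i ih =>
    funext x
    rw [xDeriv_add_single le_rfl isOpen_univ (contDiff_expDot ξ).contDiffOn J i (Set.mem_univ x),
      ih]
    have h1 : HasDerivAt (fun t : ℝ => ∑ j, ξ j * (x + t • (Pi.single i 1 : Fin N → ℝ)) j)
        (ξ i) 0 := by
      have e : ∀ t : ℝ, ∑ j, ξ j * (x + t • (Pi.single i 1 : Fin N → ℝ)) j =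
          ∑ j, ξ j * x j + t * ξ i := fun t => by
        simp [mul_add, Finset.sum_add_distrib, Pi.single_apply, mul_comm]
      simp only [e]
      simpa using ((hasDerivAt_id (0 : ℝ)).mul_const (ξ i)).const_add (∑ j, ξ j * x j)
    have h2 := (h1.exp.const_mul (∏ j, ξ j ^ J j)).deriv
    have e' : ∏ j, ξ j ^ (J + Pi.single i 1 : MultiIndex N) j = (∏ j, ξ j ^ J j) * ξ i := by
      simp only [Pi.add_apply, pow_add, Finset.prod_mul_distrib]
      congr 1
      rw [Finset.prod_eq_single i (fun j _ hj => by simp [Pi.single_eq_of_ne hj]) (by simp)]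
      simp
    simp only [zero_smul, add_zero] at h2
    rw [e', lineDeriv]
    refine h2.trans ?_
    simp only [expDot]
    ring

/-- A polynomial in `ξ` that vanishes identically has zero coefficients. -/
theorem coeff_eq_zero_of_forall (B : Finset (MultiIndex N)) (a : MultiIndex N → ℝ)
    (h : ∀ ξ : Fin N → ℝ, ∑ J ∈ B, (∏ i, ξ i ^ J i) * a J = 0) : ∀ J ∈ B, a J = 0 := by
  classical
  intro J hJ
  let e : MultiIndex N → (Fin N →₀ ℕ) := Finsupp.equivFunOnFinite.symm
  have he : Function.Injective e := Finsupp.equivFunOnFinite.symm.injective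
  have hp : (∑ J ∈ B, MvPolynomial.monomial (e J) (a J)) = 0 := by
    refine MvPolynomial.funext fun ξ => ?_
    rw [map_sum, map_zero, ← h ξ]
    refine Finset.sum_congr rfl fun J _ => ?_
    rw [MvPolynomial.eval_monomial, mul_comm,
      Finsupp.prod_fintype _ _ fun i => pow_zero _]
    rfl
  have hc := congrArg (MvPolynomial.coeff (e J)) hp
  rw [MvPolynomial.coeff_sum, Finset.sum_eq_single J] at hc
  · simpa using hc
  · intro K _ hK
    rw [MvPolynomial.coeff_monomial, if_neg fun h => hK (he h)]
  · exact fun h => absurd hJ h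

end Exponential

/-! ### Trivial divergences and equivalence of `C` with `C_λ`. -/

section Equivalence

variable {N M m R L : ℕ} {U : Set (Jet N (Fin M))} {A : Fin m → Jet N (Fin M) → ℝ}
  {C : Jet N (Fin M ⊕ Fin R) → ℝ}

/-- A linear homogeneous function, expanded in the jet coordinates of `g`. -/
theorem IsLinearHomogeneous.eq_sum {n : ℕ∞ω} (hn : ∞ ≤ n) (hU : IsOpen U)
    (hC : IsLinearHomogeneous U C) {S : Finset ((Fin M ⊕ Fin R) × MultiIndex N)}
    (hS : IsDiffFunIn n S (cyl R U) C) {z : Jet N (Fin M)} (hz : z ∈ U)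
    (γ : Fin R → MultiIndex N → ℝ) :
    C (extend z γ) = ∑ r, ∑ J ∈ orders S, gCoeff C r J z * γ r J := by
  rw [← lineDeriv_extend_zero hn hU hS hz γ]
  have h0 := hC z hz 1 0 0
  have h1 : ∀ t : ℝ, C (extend z (t • γ)) = t * C (extend z γ) := fun t => by
    have h := hC z hz t γ 0
    simp only [smul_zero, add_zero, one_mul] at h0 h
    linarith
  simp only [lineDeriv, extend_line, h1]
  simp

/-- If `C` vanishes on shell identically in `g`, then so do its coefficients. -/
theorem vanishesOnShell_gCoeff (hU : IsOpen U) (hC : IsDiffFunOf ω (cyl R U) C)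
    (hlin : IsLinearHomogeneous U C)
    (h : ∀ g : Fin R → (Fin N → ℝ) → ℝ, (∀ r, ContDiff ℝ ∞ (g r)) →
      VanishesOnShell A U (plug C g)) (r : Fin R) (J : MultiIndex N) :
    VanishesOnShell A U (gCoeff C r J) := by
  classical
  obtain ⟨S, hS⟩ := id hC
  by_cases hJ : J ∉ orders S
  · exact vanishesOnShell_zero.congr hU fun z hz => gCoeff_eq_zero hU hS hJ hz
  rw [not_not] at hJ
  have hcd : ∀ J ∈ orders S, IsDiffFunOf ω U (gCoeff C r J) := fun J _ => hC.gCoeff le_top hU r J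
  have hexp : ∀ ξ : Fin N → ℝ, IsDiffFunOf ω U (fun z => expDot ξ z.1) := fun ξ =>
    IsDiffFunOf.base (X := Set.univ) (contDiff_expDot ξ).contDiffOn fun _ _ => Set.mem_univ _
  have hsum : ∀ ξ : Fin N → ℝ, VanishesOnShell A U
      (fun z => ∑ J ∈ orders S, (∏ i, ξ i ^ J i) * gCoeff C r J z) := by
    intro ξ
    have hpd : IsDiffFunOf ω U (fun z => ∑ J ∈ orders S, (∏ i, ξ i ^ J i) * gCoeff C r J z) :=
      IsDiffFunOf.sum _ fun J hJ => (IsDiffFunOf.const _).mul (hcd J hJ)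
    -- With only the `r`-th function nonzero and exponential, `C` becomes `exp(ξ·x)` times a
    -- polynomial in `ξ` with coefficients `∂C/∂g^r_J`.
    let g : Fin R → (Fin N → ℝ) → ℝ := fun s => if s = r then expDot ξ else fun _ => 0
    have hg : ∀ s, ContDiff ℝ ∞ (g s) := fun s => by
      by_cases hs : s = r
      · simpa [g, hs] using contDiff_expDot ξ
      · simpa [g, hs] using contDiff_const
    have hplug : Set.EqOn (fun z => expDot ξ z.1 *
        ∑ J ∈ orders S, (∏ i, ξ i ^ J i) * gCoeff C r J z) (plug C g) U := by
      intro z hz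
      rw [plug, hlin.eq_sum le_top hU hS hz, Finset.sum_eq_single r]
      · simp only [jetOf, g, if_true, xDeriv_expDot, Finset.mul_sum]
        exact Finset.sum_congr rfl fun J _ => by ring
      · intro s _ hs
        simp [jetOf, g, hs, xDeriv_zero_fun]
      · simp
    -- Multiplication by `exp(-ξ·x)` removes the exponential and preserves vanishing on shell.
    have h1 := ((h g hg).congr hU hplug).mul le_top hU ((hexp ξ).mul hpd) (hexp (-ξ))
    refine h1.congr hU fun z _ => ?_
    have : expDot (-ξ) z.1 * expDot ξ z.1 = 1 := by
      rw [expDot, expDot, ← Real.exp_add]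
      simp
    rw [← mul_assoc, this, one_mul]
  intro z hz hA K
  -- At a fixed on-shell point and for fixed `K`, the powers of `ξ` are constants for `D_K`, so a
  -- polynomial in `ξ` with coefficients `D_K ∂C/∂g^r_J` vanishes identically.
  refine coeff_eq_zero_of_forall (orders S) (fun J => totalDs K (gCoeff C r J) z) (fun ξ => ?_) J hJ
  rw [← hsum ξ z hz hA K, totalDs_sum _ (fun J hJ => (IsDiffFunOf.const _).mul (hcd J hJ))
    le_top hU K hz]
  exact Finset.sum_congr rfl fun J hJ => (totalDs_const_mul (hcd J hJ) le_top hU _ K hz).symm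

/-- `Q(g)` is, for all local smooth `g`, the divergence of functions of `(x,[u],[g])` that vanish
on shell. -/
def IsTrivialDivergence (A : Fin m → Jet N (Fin M) → ℝ) (U : Set (Jet N (Fin M)))
    (Q : (Fin R → (Fin N → ℝ) → ℝ) → Jet N (Fin M) → ℝ) : Prop :=
  ∃ F : Fin N → Jet N (Fin M ⊕ Fin R) → ℝ, (∀ i, IsDiffFunOf ω (cyl R U) (F i)) ∧
    ∀ (V : Set (Fin N → ℝ)) (g : Fin R → (Fin N → ℝ) → ℝ), IsOpen V →
      (∀ r, ContDiffOn ℝ ∞ (g r) V) →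
      (∀ z ∈ U, z.1 ∈ V → Q g z = divergence (fun i => plug (F i) g) z) ∧
      ∀ i, VanishesOnShell A {z ∈ U | z.1 ∈ V} (plug (F i) g)

theorem isTrivialDivergence_zero :
    IsTrivialDivergence (R := R) A U (fun _ _ => 0) :=
  ⟨fun _ _ => 0, fun _ => IsDiffFunOf.const 0, fun _ _ _ _ =>
    ⟨fun z _ _ => (divergence_zero z).symm, fun _ => vanishesOnShell_zero⟩⟩

theorem isDiffFunOf_plug_smooth {F : Jet N (Fin M ⊕ Fin R) → ℝ}
    (hF : IsDiffFunOf ω (cyl R U) F) {V : Set (Fin N → ℝ)} (hV : IsOpen V)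
    {g : Fin R → (Fin N → ℝ) → ℝ} (hg : ∀ r, ContDiffOn ℝ ∞ (g r) V) :
    IsDiffFunOf ∞ {z ∈ U | z.1 ∈ V} (plug F g) :=
  (hF.of_le le_top).plug le_rfl hV hg

theorem IsTrivialDivergence.sub (hU : IsOpen U)
    {Q Q' : (Fin R → (Fin N → ℝ) → ℝ) → Jet N (Fin M) → ℝ}
    (hQ : IsTrivialDivergence A U Q) (hQ' : IsTrivialDivergence A U Q') :
    IsTrivialDivergence A U (fun g z => Q g z - Q' g z) := by
  obtain ⟨F, hF, h⟩ := hQ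
  obtain ⟨F', hF', h'⟩ := hQ'
  refine ⟨fun i w => F i w - F' i w, fun i => (hF i).sub (hF' i), fun V g hV hg => ?_⟩
  have hd := fun i => isDiffFunOf_plug_smooth (hF i) hV hg
  have hd' := fun i => isDiffFunOf_plug_smooth (hF' i) hV hg
  refine ⟨fun z hz hzV => ?_, fun i => ?_⟩
  · change Q g z - Q' g z = _
    rw [(h V g hV hg).1 z hz hzV, (h' V g hV hg).1 z hz hzV]
    exact (divergence_sub le_rfl (isOpen_over hU hV) hd hd' ⟨hz, hzV⟩).symm
  · exact ((h V g hV hg).2 i).sub le_rfl (isOpen_over hU hV) ((h' V g hV hg).2 i) (hd i) (hd' i)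

theorem IsTrivialDivergence.congr {Q Q' : (Fin R → (Fin N → ℝ) → ℝ) → Jet N (Fin M) → ℝ}
    (hQ : IsTrivialDivergence A U Q)
    (h : ∀ (V : Set (Fin N → ℝ)) (g : Fin R → (Fin N → ℝ) → ℝ), IsOpen V →
      (∀ r, ContDiffOn ℝ ∞ (g r) V) → ∀ z ∈ U, z.1 ∈ V → Q' g z = Q g z) :
    IsTrivialDivergence A U Q' := by
  obtain ⟨F, hF, hFQ⟩ := hQ
  exact ⟨F, hF, fun V g hV hg => ⟨fun z hz hzV =>
    (h V g hV hg z hz hzV).trans ((hFQ V g hV hg).1 z hz hzV), (hFQ V g hV hg).2⟩⟩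

theorem IsTrivialDivergence.add (hU : IsOpen U)
    {Q Q' : (Fin R → (Fin N → ℝ) → ℝ) → Jet N (Fin M) → ℝ}
    (hQ : IsTrivialDivergence A U Q) (hQ' : IsTrivialDivergence A U Q') :
    IsTrivialDivergence A U (fun g z => Q g z + Q' g z) := by
  refine (hQ.sub hU (isTrivialDivergence_zero.sub hU hQ')).congr fun _ g _ _ z _ _ => ?_
  ring

theorem IsTrivialDivergence.sum (hU : IsOpen U) {ι : Type*} (s : Finset ι)
    {Q : ι → (Fin R → (Fin N → ℝ) → ℝ) → Jet N (Fin M) → ℝ}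
    (hQ : ∀ k ∈ s, IsTrivialDivergence A U (Q k)) :
    IsTrivialDivergence A U (fun g z => ∑ k ∈ s, Q k g z) := by
  classical
  induction s using Finset.induction_on with
  | empty => simpa using isTrivialDivergence_zero
  | insert a s ha ih =>
    simp only [Finset.sum_insert ha]
    exact (hQ a (by simp)).add hU (ih fun k hk => hQ k (by simp [hk]))

/-- The flux is `c g^r_J` in slot `i` and zero elsewhere; it vanishes on shell because `c` does. -/
theorem isTrivialDivergence_totalD (hU : IsOpen U) {c : Jet N (Fin M) → ℝ}
    (hc : IsDiffFunOf ω U c) (hcA : VanishesOnShell A U c) (r : Fin R) (J : MultiIndex N)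
    (i : Fin N) : IsTrivialDivergence A U
      (fun g z => totalD i (fun y : Jet N (Fin M) => c y * jetOf g y.1 r J) z) := by
  refine ⟨fun k w => if k = i then c (reindex Sum.inl w) * w.2 (Sum.inr r) J else 0,
    fun k => ?_, fun V g hV hg => ?_⟩
  · by_cases hk : k = i
    · simp only [hk, if_true]
      exact (hc.reindex Sum.inl).mul (IsDiffFunOf.coord _ _)
    · simpa only [hk, if_false] using IsDiffFunOf.const 0
  have e : ∀ k, plug (fun w => if k = i then c (reindex Sum.inl w) * w.2 (Sum.inr r) J else 0) g =
      if k = i then fun y : Jet N (Fin M) => c y * jetOf g y.1 r J else fun _ => 0 := by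
    intro k
    by_cases hk : k = i
    · simp only [hk, if_true]; rfl
    · simp only [hk, if_false]; rfl
  refine ⟨fun z hz hzV => ?_, fun k => ?_⟩
  · simp only [divergence, e]
    rw [Finset.sum_eq_single i]
    · simp
    · intro k _ hk
      simp [hk, totalD_const]
    · simp
  · rw [e]
    by_cases hk : k = i
    · simp only [hk, if_true]
      have hsub : {z ∈ U | z.1 ∈ V} ⊆ U := fun _ h => h.1
      have hjet : IsDiffFunOf ∞ {z ∈ U | z.1 ∈ V}
          (fun y : Jet N (Fin M) => jetOf g y.1 r J) :=
        IsDiffFunOf.base (contDiffOn_xDeriv le_rfl hV (hg r) J) fun _ h => h.2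
      simpa only [mul_comm] using (hcA.mono hsub).mul le_rfl (isOpen_over hU hV)
        ((hc.mono hsub).of_le le_top) hjet
    · simpa only [hk, if_false] using vanishesOnShell_zero

/-- Integration by parts, with boundary terms that vanish on shell. -/
theorem isTrivialDivergence_by_parts (hU : IsOpen U) {c : Jet N (Fin M) → ℝ}
    (hc : IsDiffFunOf ω U c) (hcA : VanishesOnShell A U c) (r : Fin R) (J : MultiIndex N) :
    IsTrivialDivergence A U
      (fun g z => c z * jetOf g z.1 r J - negDs J c z * g r z.1) := by
  induction J using multiIndex_induction generalizing c with
  | h0 =>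
    refine isTrivialDivergence_zero.congr fun _ g _ _ z _ _ => ?_
    simp [jetOf, xDeriv, multiPow_zero, negDs_zero]
  | hs J i ih =>
    -- `c g^r_{J+1_i} = D_i(c g^r_J) - (D_i c) g^r_J`, and `D_i c` again vanishes on shell, so the
    -- induction hypothesis applies to it.
    refine ((isTrivialDivergence_totalD hU hc hcA r J i).sub hU
      (ih (hc.totalD le_top hU i) (hcA.totalD le_top hU hc i))).congr
      fun V g hV hg z hz hzV => ?_
    have hsub : {z ∈ U | z.1 ∈ V} ⊆ U := fun _ h => h.1
    have hjet : IsDiffFunOf ∞ {z ∈ U | z.1 ∈ V}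
        (fun y : Jet N (Fin M) => jetOf g y.1 r J) :=
      IsDiffFunOf.base (contDiffOn_xDeriv le_rfl hV (hg r) J) fun _ h => h.2
    rw [totalD_mul ((hc.mono hsub).of_le le_top) hjet le_rfl (isOpen_over hU hV) i ⟨hz, hzV⟩,
      negDs_add_single hc le_top hU J i hz]
    have : totalD i (fun y : Jet N (Fin M) => jetOf g y.1 r J) z =
        jetOf g z.1 r (J + Pi.single i 1) :=
      (totalD_base (xDeriv J (g r)) i z).trans (xDeriv_add_single le_rfl hV (hg r) J i hzV).symm
    rw [this]
    ring

/-- `C` differs from `g^r (-D)_J (∂C/∂g^r_J)` by a trivial divergence. -/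
theorem isTrivialDivergence_sub_eulerG (hU : IsOpen U) (hC : IsDiffFunOf ω (cyl R U) C)
    (hlin : IsLinearHomogeneous U C)
    (h : ∀ g : Fin R → (Fin N → ℝ) → ℝ, (∀ r, ContDiff ℝ ∞ (g r)) →
      VanishesOnShell A U (plug C g)) :
    IsTrivialDivergence A U (fun g z => plug C g z - ∑ r, g r z.1 * eulerG C r z) := by
  obtain ⟨S, hS⟩ := id hC
  refine (IsTrivialDivergence.sum hU Finset.univ fun r _ => IsTrivialDivergence.sum hU (orders S)
    fun J _ => isTrivialDivergence_by_parts hU (hC.gCoeff le_top hU r J)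
      (vanishesOnShell_gCoeff hU hC hlin h r J) r J).congr fun V g hV hg z hz hzV => ?_
  rw [plug, hlin.eq_sum le_top hU hS hz, ← Finset.sum_sub_distrib]
  refine Finset.sum_congr rfl fun r _ => ?_
  rw [eulerG_eq_sum hU hS subset_rfl hz, Finset.mul_sum, ← Finset.sum_sub_distrib]
  exact Finset.sum_congr rfl fun J _ => by ring

variable {X : Set (Fin N → ℝ)} {d : Fin L → Fin R → MultiIndex N →₀ ((Fin N → ℝ) → ℝ)}
  {lam : Fin L → Jet N (Fin M) → ℝ}

/-- On admissible `g` the terms `λ_l 𝒟^l_r g^r` drop out, and the defining equation of `λ` rewrites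
what remains. -/
theorem plug_multiplierLaw {V : Set (Fin N → ℝ)} {g : Fin R → (Fin N → ℝ) → ℝ}
    (hg : IsAdmissible d V g) (hlam : IsMultiplier d U C lam) {z : Jet N (Fin M)} (hz : z ∈ U)
    (hzV : z.1 ∈ V) : plug (multiplierLaw d lam) g z = ∑ r, g r z.1 * eulerG C r z := by
  change ∑ l, lam l z * constraint d l (z.1, jetOf g z.1) -
    ∑ r, jetOf g z.1 r 0 * adjointSum d lam r z = _
  simp only [hg.2 _ _ hzV, mul_zero, Finset.sum_const_zero, zero_sub, ← Finset.sum_neg_distrib]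
  refine Finset.sum_congr rfl fun r _ => ?_
  have h := hlam.2 r z hz
  rw [eq_neg_of_add_eq_zero_left h, jetOf, xDeriv, multiPow_zero]
  ring

theorem isDiffFunOf_adjointSum (hX : IsOpen X) (hU : IsOpen U) (hUX : ∀ z ∈ U, z.1 ∈ X)
    (hd : ∀ l r J, AnalyticOnNhd ℝ (d l r J) X) (hlam : ∀ l, IsDiffFunOf ω U (lam l))
    (r : Fin R) : IsDiffFunOf ω U (adjointSum d lam r) :=
  IsDiffFunOf.sum _ fun l _ => IsDiffFunOf.adjointOp le_top hU
    (fun J => isDiffFunOf_base_of_analyticOnNhd hX hUX (hd l r J)) (hlam l)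

theorem isDiffFunOf_multiplierLaw (hX : IsOpen X) (hU : IsOpen U) (hUX : ∀ z ∈ U, z.1 ∈ X)
    (hd : ∀ l r J, AnalyticOnNhd ℝ (d l r J) X) (hlam : ∀ l, IsDiffFunOf ω U (lam l)) :
    IsDiffFunOf ω (cyl R U) (multiplierLaw d lam) := by
  have hsub : ∀ w ∈ cyl R U, w ∈ reindex Sum.inr ⁻¹' {w : Jet N (Fin R) | w.1 ∈ X} :=
    fun w hw => hUX _ hw
  exact (IsDiffFunOf.sum _ fun l _ => ((hlam l).reindex Sum.inl).mul
    (((isDiffFunOf_constraint hX hd l).reindex Sum.inr).mono hsub)).sub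
    (IsDiffFunOf.sum _ fun r _ => (IsDiffFunOf.coord (Sum.inr r) 0).mul
      ((isDiffFunOf_adjointSum hX hU hUX hd hlam r).reindex Sum.inl))

theorem isLinearHomogeneous_multiplierLaw : IsLinearHomogeneous U (multiplierLaw d lam) := by
  intro z _ c γ γ'
  change ∑ l, lam l z * constraint d l (z.1, c • γ + γ') -
      ∑ r, (c • γ + γ') r 0 * adjointSum d lam r z =
    c * (∑ l, lam l z * constraint d l (z.1, γ) - ∑ r, γ r 0 * adjointSum d lam r z) +
      (∑ l, lam l z * constraint d l (z.1, γ') - ∑ r, γ' r 0 * adjointSum d lam r z)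
  simp only [constraint_lin, Pi.add_apply, Pi.smul_apply, smul_eq_mul, mul_add, add_mul,
    Finset.sum_add_distrib, mul_sub, Finset.mul_sum, mul_left_comm, mul_assoc]
  ring

/-- Replacing a function by its negative on `U` in a syzygy. -/
theorem applyOp_neg_of_eqOn (hU : IsOpen U) (P : MultiIndex N →₀ (Jet N (Fin M) → ℝ))
    {f h : Jet N (Fin M) → ℝ} (hfh : ∀ z ∈ U, f z + h z = 0) {z : Jet N (Fin M)} (hz : z ∈ U) :
    applyOp P f z = -applyOp P h z := by
  have e : ∀ J, totalDs J f z = -totalDs J h z := fun J => by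
    rw [totalDs_eqOn hU J (g := fun y => -h y)
      (fun y hy => eq_neg_of_add_eq_zero_left (hfh y hy)) hz, totalDs_neg]
  simp only [applyOp, Finsupp.sum, e, mul_neg, Finset.sum_neg_distrib]

end Equivalence

end ConsLaw

end

/-! ### The theorem, assembled from its three parts. -/

theorem mainTheorem1 {N M m R L : ℕ}
    (X : Set (Fin N → ℝ)) (hX : IsOpen X)
    (U : Set (Jet N (Fin M))) (hU : IsOpen U) (hUX : ∀ z ∈ U, z.1 ∈ X)
    (A : Fin m → Jet N (Fin M) → ℝ) (hA : ∀ μ, IsDiffFun U (A μ))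
    (d : Fin L → Fin R → MultiIndex N →₀ ((Fin N → ℝ) → ℝ))
    (hd : ∀ l r J, AnalyticOnNhd ℝ (d l r J) X) (hcomplete : IsCompleteSystem d X)
    (C : Jet N (Fin M ⊕ Fin R) → ℝ) (hC : IsConservationLawFamily A d X U C) :
    (∃ lam : Fin L → Jet N (Fin M) → ℝ, IsMultiplier d U C lam) ∧
    (∀ lam : Fin L → Jet N (Fin M) → ℝ, IsMultiplier d U C lam →
      ∀ P : Fin R → MultiIndex N →₀ (Jet N (Fin M) → ℝ), (∀ r J, IsDiffFun U (P r J)) →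
        (∀ z ∈ U, ∑ r, applyOp (P r) (adjointSum d lam r) z = 0) →
        ∀ z ∈ U, ∑ r, applyOp (P r) (eulerG C r) z = 0) ∧
    ((∀ g : Fin R → (Fin N → ℝ) → ℝ, (∀ r, ContDiff ℝ ∞ (g r)) → VanishesOnShell A U (plug C g)) →
      ∀ lam : Fin L → Jet N (Fin M) → ℝ, IsMultiplier d U C lam →
        IsConservationLawFamily A d X U (multiplierLaw d lam) ∧
        AreEquivalent A d X U C (multiplierLaw d lam)) := by
  obtain ⟨hCd, hlin, F, hF, hsol⟩ := hC
  have hcyl : IsOpen (cyl R U) := isOpen_cyl hU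
  rw [isDiffFun_iff hcyl] at hCd
  simp only [isDiffFun_iff hcyl] at hF
  refine ⟨?_, ?_, ?_⟩
  · exact exists_isMultiplier hX hU hUX hd hcomplete hCd hF
      fun V g hV hVX hg => (hsol V g hV hVX hg).1
  · intro lam hlam P _ hP z hz
    have e := fun r => applyOp_neg_of_eqOn hU (P r) (hlam.2 r) hz
    simp only [e, Finset.sum_neg_distrib, hP z hz, neg_zero]
  · intro hshell lam hlam
    -- `G` serves all smooth `g`; the constraints enter only when the remainder `g^r (-D)_J
    -- (∂C/∂g^r_J)` is identified with `C_λ`.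
    obtain ⟨G, hG, hGC⟩ := isTrivialDivergence_sub_eulerG hU hCd hlin hshell
    have hlamd : ∀ l, IsDiffFunOf ω U (lam l) := fun l => (isDiffFun_iff hU).1 (hlam.1 l)
    have hdiff : ∀ V g, IsOpen V → IsAdmissible d V g → ∀ z ∈ U, z.1 ∈ V →
        plug C g z - plug (multiplierLaw d lam) g z = divergence (fun i => plug (G i) g) z :=
      fun V g hV hg z hz hzV => by
        rw [plug_multiplierLaw hg hlam hz hzV]
        exact (hGC V g hV hg.1).1 z hz hzV
    -- Since `C_λ = C - D_i G^i` on admissible `g`, the fluxes of `C_λ` are `F - G`, and `G` itself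
    -- gives the equivalence.
    refine ⟨⟨(isDiffFun_iff hcyl).2 (isDiffFunOf_multiplierLaw hX hU hUX hd hlamd),
      isLinearHomogeneous_multiplierLaw, fun i w => F i w - G i w,
      fun i => (isDiffFun_iff hcyl).2 ((hF i).sub (hG i)), fun V g hV hVX hg => ?_⟩,
      G, fun i => (isDiffFun_iff hcyl).2 (hG i), fun V g hV _ hg =>
        ⟨hdiff V g hV hg, (hGC V g hV hg.1).2⟩⟩
    have hW : IsOpen {z ∈ U | z.1 ∈ V} := isOpen_over hU hV
    have hFd := fun i => isDiffFunOf_plug_smooth (hF i) hV hg.1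
    have hGd := fun i => isDiffFunOf_plug_smooth (hG i) hV hg.1
    obtain ⟨hdiv, hvan⟩ := hsol V g hV hVX hg
    refine ⟨fun z hz hzV => ?_, ?_⟩
    · have h1 := hdiff V g hV hg z hz hzV
      have h2 : divergence (fun i => plug (fun w => F i w - G i w) g) z =
          divergence (fun i => plug (F i) g) z - divergence (fun i => plug (G i) g) z :=
        divergence_sub le_rfl hW hFd hGd ⟨hz, hzV⟩
      rw [h2, ← hdiv z hz hzV, ← h1]
      ring
    -- `C_λ` vanishes on shell because `C` does and the divergence of the on-shell vanishing `G`
    -- does.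
    · refine (hvan.sub le_rfl hW
        (VanishesOnShell.divergence le_rfl hW (hGC V g hV hg.1).2 hGd)
        (isDiffFunOf_plug_smooth hCd hV hg.1)
        (IsDiffFunOf.sum _ fun i _ => (hGd i).totalD le_rfl hW i)).congr hW fun z hz => ?_
      have h1 := hdiff V g hV hg z hz.1 hz.2
      rw [← h1]
      ring
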